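/- For each $n\ge 1$ let $\gamma_n>0$, $\tau_n>0$, $\sigma_n\in\mathbb{R}$, and let $(Z^{(n)}_t)_{t\ge 0}$ be the stationary Ornstein--Uhlenbeck process $dZ_t=-\gamma_n Z_t\,dt+\sigma_n\,dW_t$, with $Z_0\sim N(0,\sigma_n^2/(2\gamma_n))$ independent of the Brownian motion $W$. Fix $\rho>0$ and $x_0>0$, and define the growth process by $x^{(n)}_0=x_0$ and $$x^{(n)}_{i+1}=\Bigl(1+\rho\,e^{Z^{(n)}_{t_i}-\frac12\mathrm{Var}(Z^{(n)}_{t_i})}\Bigr)x^{(n)}_i,\qquad t_i=i\tau_n .$$ Assume that $\beta=\tfrac12\sigma_n^2\tau_n n^2$ and $a=\gamma_n n\tau_n$ do not depend on $n$. Then $\mathbb{E}[x^{(n)}_n]<\infty$ for every $n\ge 1$, and the limit $$\lambda(\rho,\beta,a)=\lim_{n\to\infty}\frac1n\log\mathbb{E}\bigl[x^{(n)}_n\bigr]$$ exists, is finite, and is given by $$\lambda(\rho,\beta,a)=\sup_{g\in\mathcal{G}}\Lambda[g],\qquad \Lambda[g]=g(1)\log\rho+\beta\int_0^1\!\!\int_0^1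 g'(y)g'(z)K(y,z)\,dy\,dz-\int_0^1 I(g'(x))\,dx,$$ where $K(y,z)=\frac{1}{2a}e^{-a|y-z|}$, $I(x)=x\log x+(1-x)\log(1-x)$ (with $0\log 0=0$), and $\mathcal{G}$ is the set of absolutely continuous functions $g:[0,1]\to[0,1]$ with $g(0)=0$ and $0\le g'(x)\le 1$ for almost every $x\in[0,1]$. -/

import Mathlib

open MeasureTheory ProbabilityTheory Filter Topology Set
open scoped NNReal

noncomputable section

/-- `Z` is a stationary Ornstein-Uhlenbeck process `dZ_t = -γ Z_t dt + σ dW_t`, `t ≥ 0`, driven by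
the standard Brownian motion `W`. The noise is additive, so the stochastic differential equation is
the pathwise integral equation in the last field. The initial value is independent of `W` and
has the invariant law `N(0, σ² / (2γ))`. -/
structure IsStationaryOU {Ω : Type*} [MeasurableSpace Ω] (P : Measure Ω) (γ σ : ℝ)
    (W Z : ℝ≥0 → Ω → ℝ) : Prop where
  brownian : IsBrownianReal W P
  initial_law : HasLaw (Z 0) (gaussianReal 0 (Real.toNNReal (σ ^ 2 / (2 * γ)))) P
  initial_indep : IndepFun (Z 0) (fun ω t => W t ω) P
  continuous_paths : ∀ᵐ ω ∂P, Continuous (fun t : ℝ≥0 => Z t ω)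
  sde : ∀ᵐ ω ∂P, ∀ t : ℝ≥0,
    Z t ω = Z 0 ω - γ * (∫ s in (0 : ℝ)..(t : ℝ), Z (Real.toNNReal s) ω) + σ * W t ω

/-- The growth process `x_{i+1} = (1 + ρ exp (Y_i - Var(Y_i) / 2)) x_i` with deterministic initial
value `x₀`, driven by a sequence `Y` of real random variables. -/
def growthProcess {Ω : Type*} [MeasurableSpace Ω] (P : Measure Ω) (ρ x₀ : ℝ)
    (Y : ℕ → Ω → ℝ) : ℕ → Ω → ℝ
  | 0, _ => x₀
  | i + 1, ω =>
      (1 + ρ * Real.exp (Y i ω - (1 / 2) * variance (Y i) P)) * growthProcess P ρ x₀ Y i ω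

/-- The process `Z` sampled at the times `t_i = i τ`. -/
def sampled {Ω : Type*} (τ : ℝ) (Z : ℝ≥0 → Ω → ℝ) (i : ℕ) : Ω → ℝ :=
  Z (Real.toNNReal (i * τ))

/-- The interaction kernel `K(y, z) = exp (-a |y - z|) / (2a)`. -/
def interactionKernel (a y z : ℝ) : ℝ :=
  1 / (2 * a) * Real.exp (-a * |y - z|)

/-- The entropy function `I(x) = x log x + (1 - x) log (1 - x)`, with `0 log 0 = 0`. -/
def entropyFn (x : ℝ) : ℝ :=
  x * Real.log x + (1 - x) * Real.log (1 - x)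

/-- The absolutely continuous `g : [0, 1] → [0, 1]` with `g 0 = 0` and `0 ≤ g' ≤ 1`
almost everywhere; the values of `g` outside `[0, 1]` play no role. -/
def admissibleSet : Set (ℝ → ℝ) :=
  {g | MapsTo g (Icc 0 1) (Icc 0 1) ∧ g 0 = 0 ∧ AbsolutelyContinuousOnInterval g 0 1 ∧
    ∀ᵐ x ∂(volume.restrict (Icc (0 : ℝ) 1)), 0 ≤ deriv g x ∧ deriv g x ≤ 1}

/-- The functional `Λ[g]`. -/
def rateFunctional (ρ β a : ℝ) (g : ℝ → ℝ) : ℝ :=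
  Real.log ρ * g 1
    + β * (∫ y in (0 : ℝ)..1, ∫ z in (0 : ℝ)..1, deriv g y * deriv g z * interactionKernel a y z)
    - ∫ x in (0 : ℝ)..1, entropyFn (deriv g x)

end

/-! Expanding the product over the subsets `S` of `{0, …, n-1}` of factors carrying the exponential,
and using `E e^X = e^{Var X / 2}` for centred Gaussian `X`, turns `E x_n` into `x₀` times the
partition function of a lattice gas (`IsStationaryOU.integral_growth_eq`). Its pair interaction is
`(β/n) K(i/n, j/n)`, a weak long-range coupling for which mean-field theory is exact to leading
order.

The kernel is positive semidefinite (`quadForm_exp_neg_abs_sub_nonneg`), so the energy `Q` is convex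
and lies above each linearization, by exactly `Q(1_S - θ)`. A linear energy makes the sites
independent, and `log (1 + e^h)` is the maximum of `u h - I(u)` over `u ∈ [0, 1]`. Linearizing at
any profile bounds the partition function below by its mean-field value
(`exp_meanFieldEnergy_le_partitionSum`). For the upper bound, each configuration is linearized at
its average over `m` blocks (`partitionSum_le_of_blocks`): there are at most `(n+1)^m` such
averages, costing `o(n)` in the logarithm, and the error is `O(n/m)` because `K` is Lipschitz. Then
`n → ∞` and `m → ∞`.

Mean-field values and `Λ` differ by `O(1/n)` per site: averaging `g'` over cells can only lower the
entropy integral (Jensen), and step profiles give admissible `g`.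

The Gaussian input avoids stochastic integration: `e^{γt} Z_t - Z_0` is a pathwise limit of
Riemann-Stieltjes sums of Brownian increments (`tendsto_expStieltjesSum`). -/

/-! ### Mean-field bounds for a lattice gas with positive semidefinite interaction -/

section LatticeGas

/-- The quadratic form of a kernel `κ` restricted to a finite set of sites. -/
def quadForm (s : Finset ℕ) (κ : ℕ → ℕ → ℝ) (c : ℕ → ℝ) : ℝ :=
  ∑ i ∈ s, ∑ j ∈ s, c i * c j * κ i j

/-- The partition function of the lattice gas on `s` with chemical potential `L` and pair
interaction `κ`. -/
noncomputable def partitionSum (s : Finset ℕ) (L : ℝ) (κ : ℕ → ℕ → ℝ) : ℝ :=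
  ∑ S ∈ s.powerset, Real.exp (L * S.card + ∑ i ∈ S, ∑ j ∈ S, κ i j)

/-- The mean-field free energy of an occupation profile `u`. -/
noncomputable def meanFieldEnergy (s : Finset ℕ) (L : ℝ) (κ : ℕ → ℕ → ℝ) (u : ℕ → ℝ) : ℝ :=
  ∑ i ∈ s, (L * u i - entropyFn (u i)) + quadForm s κ u

theorem exp_mul_sub_entropyFn_le {u : ℝ} (hu : u ∈ Icc (0 : ℝ) 1) (x : ℝ) :
    Real.exp (u * x - entropyFn u) ≤ 1 + Real.exp x := by
  rcases hu.1.eq_or_lt with rfl | h0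
  · simpa [entropyFn] using (Real.exp_pos x).le
  rcases hu.2.eq_or_lt with rfl | h1
  · simp [entropyFn]
  have h1' : 0 < 1 - u := by linarith
  -- Jensen with weights `u` and `1 - u`; the two points are chosen so that the weights cancel
  -- against the exponentials.
  have h := convexOn_exp.2 (mem_univ (x - Real.log u)) (mem_univ (-Real.log (1 - u)))
    h0.le h1'.le (by ring)
  simp only [smul_eq_mul, Real.exp_sub, Real.exp_neg, Real.exp_log h0, Real.exp_log h1'] at h
  calc Real.exp (u * x - entropyFn u)
      = Real.exp (u * (x - Real.log u) + (1 - u) * -Real.log (1 - u)) := by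
        congr 1; unfold entropyFn; ring
    _ ≤ _ := h
    _ = 1 + Real.exp x := by field_simp; ring

theorem exists_exp_mul_sub_entropyFn_eq (x : ℝ) :
    ∃ u ∈ Icc (0 : ℝ) 1, 1 + Real.exp x = Real.exp (u * x - entropyFn u) := by
  have hx := Real.exp_pos x
  have hp : 0 < 1 + Real.exp x := by positivity
  -- The logistic function, the stationary point of `u x - I(u)`.
  refine ⟨Real.exp x / (1 + Real.exp x), ⟨by positivity, by rw [div_le_one hp]; linarith⟩, ?_⟩
  have h1 : 1 - Real.exp x / (1 + Real.exp x) = 1 / (1 + Real.exp x) := by field_simp; ring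
  rw [entropyFn, h1, Real.log_div hx.ne' hp.ne', Real.log_exp, Real.log_div one_ne_zero hp.ne',
    Real.log_one]
  nth_rw 1 [← Real.exp_log hp]
  congr 1
  field_simp
  ring

/-- Polarization: the interaction is replaced by the external field generated by `θ`, and the error
is itself a value of the form. -/
theorem quadForm_eq_linearize {s : Finset ℕ} {κ : ℕ → ℕ → ℝ} (hκ : ∀ i j, κ i j = κ j i)
    (x θ : ℕ → ℝ) :
    quadForm s κ x = ∑ i ∈ s, x i * (2 * ∑ j ∈ s, θ j * κ i j) - quadForm s κ θ
      + quadForm s κ (fun i => x i - θ i) := by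
  have h : ∑ i ∈ s, ∑ j ∈ s, x i * θ j * κ i j = ∑ i ∈ s, ∑ j ∈ s, θ i * x j * κ i j := by
    rw [Finset.sum_comm]
    refine Finset.sum_congr rfl fun i _ => Finset.sum_congr rfl fun j _ => ?_
    rw [hκ i j]; ring
  have h1 : ∑ i ∈ s, x i * (2 * ∑ j ∈ s, θ j * κ i j)
      = 2 * ∑ i ∈ s, ∑ j ∈ s, x i * θ j * κ i j := by
    simp only [Finset.mul_sum]
    refine Finset.sum_congr rfl fun i _ => Finset.sum_congr rfl fun j _ => by ring
  have h2 : quadForm s κ (fun i => x i - θ i) = quadForm s κ x + quadForm s κ θ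
      - ∑ i ∈ s, ∑ j ∈ s, x i * θ j * κ i j - ∑ i ∈ s, ∑ j ∈ s, θ i * x j * κ i j := by
    simp only [quadForm, ← Finset.sum_add_distrib, ← Finset.sum_sub_distrib]
    refine Finset.sum_congr rfl fun i _ => Finset.sum_congr rfl fun j _ => by ring
  rw [h1, h2, ← h]
  ring

theorem hamiltonian_eq_linearize {s S : Finset ℕ} (hS : S ⊆ s) {κ : ℕ → ℕ → ℝ}
    (hκ : ∀ i j, κ i j = κ j i) (L : ℝ) (θ : ℕ → ℝ) :
    L * S.card + ∑ i ∈ S, ∑ j ∈ S, κ i j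
      = ∑ i ∈ S, (L + 2 * ∑ j ∈ s, θ j * κ i j) - quadForm s κ θ
        + quadForm s κ (fun i => (if i ∈ S then 1 else 0) - θ i) := by
  have h := quadForm_eq_linearize (s := s) hκ (fun i => if i ∈ S then 1 else 0) θ
  have h1 : quadForm s κ (fun i => if i ∈ S then 1 else 0) = ∑ i ∈ S, ∑ j ∈ S, κ i j := by
    have h0 : ∀ f : ℕ → ℝ, ∑ i ∈ s, (if i ∈ S then (1 : ℝ) else 0) * f i = ∑ i ∈ S, f i := by
      intro f
      simp only [ite_mul, one_mul, zero_mul, ← Finset.sum_filter, Finset.filter_mem_eq_inter,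
        Finset.inter_eq_right.2 hS]
    simp only [quadForm, mul_assoc, ← Finset.mul_sum, h0]
  have h2 : ∑ i ∈ s, (if i ∈ S then (1 : ℝ) else 0) * (2 * ∑ j ∈ s, θ j * κ i j)
      = ∑ i ∈ S, 2 * ∑ j ∈ s, θ j * κ i j := by
    simp only [ite_mul, one_mul, zero_mul, ← Finset.sum_filter, Finset.filter_mem_eq_inter,
      Finset.inter_eq_right.2 hS]
  rw [← h1, h, h2, Finset.sum_add_distrib, Finset.sum_const, nsmul_eq_mul]
  ring

theorem sum_powerset_exp_sum (s : Finset ℕ) (h : ℕ → ℝ) (q : ℝ) :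
    ∑ S ∈ s.powerset, Real.exp (∑ i ∈ S, h i - q)
      = Real.exp (-q) * ∏ i ∈ s, (1 + Real.exp (h i)) := by
  rw [Finset.prod_one_add, Finset.mul_sum]
  refine Finset.sum_congr rfl fun S _ => ?_
  rw [sub_eq_neg_add, Real.exp_add, Real.exp_sum]

theorem exp_meanFieldEnergy_le_partitionSum {s : Finset ℕ} {κ : ℕ → ℕ → ℝ}
    (hκ : ∀ i j, κ i j = κ j i) (hpos : ∀ c, 0 ≤ quadForm s κ c) (L : ℝ) {u : ℕ → ℝ}
    (hu : ∀ i, u i ∈ Icc (0 : ℝ) 1) :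
    Real.exp (meanFieldEnergy s L κ u) ≤ partitionSum s L κ := by
  calc Real.exp (meanFieldEnergy s L κ u)
      = Real.exp (-quadForm s κ u) * ∏ i ∈ s,
          Real.exp (u i * (L + 2 * ∑ j ∈ s, u j * κ i j) - entropyFn (u i)) := by
        rw [← Real.exp_sum, ← Real.exp_add]
        congr 1
        have h := quadForm_eq_linearize (s := s) hκ u u
        have h0 : quadForm s κ (fun i => u i - u i) = 0 := by simp [quadForm]
        rw [h0] at h
        have h3 : ∑ i ∈ s, (u i * (L + 2 * ∑ j ∈ s, u j * κ i j) - entropyFn (u i))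
            = ∑ i ∈ s, (L * u i - entropyFn (u i))
              + ∑ i ∈ s, u i * (2 * ∑ j ∈ s, u j * κ i j) := by
          rw [← Finset.sum_add_distrib]
          exact Finset.sum_congr rfl fun i _ => by ring
        rw [h3, meanFieldEnergy]
        linarith
    _ ≤ Real.exp (-quadForm s κ u) * ∏ i ∈ s,
          (1 + Real.exp (L + 2 * ∑ j ∈ s, u j * κ i j)) := by
        gcongr with i
        exact exp_mul_sub_entropyFn_le (hu i) _
    _ ≤ partitionSum s L κ := by
        rw [← sum_powerset_exp_sum]
        refine Finset.sum_le_sum fun S hS => Real.exp_le_exp.2 ?_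
        rw [hamiltonian_eq_linearize (Finset.mem_powerset.1 hS) hκ L u]
        linarith [hpos (fun i => (if i ∈ S then 1 else 0) - u i)]

/-- Each configuration is charged to a nearby net point, at cost `e^d`; the linearized sum at each
net point factorises over the sites and is at most `e^M`. -/
theorem partitionSum_le_of_net {s : Finset ℕ} {κ : ℕ → ℕ → ℝ}
    (hκ : ∀ i j, κ i j = κ j i) (hpos : ∀ c, 0 ≤ quadForm s κ c) {L M d : ℝ}
    (hM : ∀ u : ℕ → ℝ, (∀ i, u i ∈ Icc (0 : ℝ) 1) → meanFieldEnergy s L κ u ≤ M)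
    {ι : Type*} [Fintype ι] (θ : ι → ℕ → ℝ)
    (hθ : ∀ S ⊆ s, ∃ k, quadForm s κ (fun i => (if i ∈ S then 1 else 0) - θ k i) ≤ d) :
    partitionSum s L κ ≤ Fintype.card ι * Real.exp (M + d) := by
  have hk : ∀ k, ∑ S ∈ s.powerset, Real.exp (∑ i ∈ S, (L + 2 * ∑ j ∈ s, θ k j * κ i j)
      - quadForm s κ (θ k)) ≤ Real.exp M := by
    intro k
    choose u hu hue using fun i =>
      exists_exp_mul_sub_entropyFn_eq (L + 2 * ∑ j ∈ s, θ k j * κ i j)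
    rw [sum_powerset_exp_sum]
    simp only [hue]
    rw [← Real.exp_sum, ← Real.exp_add, Real.exp_le_exp]
    -- With `u` optimal at each site, the exponent is the mean-field energy of `u` minus the form at
    -- `u - θ k`, which is nonnegative.
    refine le_trans ?_ (hM u hu)
    have h := quadForm_eq_linearize (s := s) hκ u (θ k)
    have h3 : ∑ i ∈ s, (u i * (L + 2 * ∑ j ∈ s, θ k j * κ i j) - entropyFn (u i))
        = ∑ i ∈ s, (L * u i - entropyFn (u i))
          + ∑ i ∈ s, u i * (2 * ∑ j ∈ s, θ k j * κ i j) := by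
      rw [← Finset.sum_add_distrib]
      exact Finset.sum_congr rfl fun i _ => by ring
    rw [h3, meanFieldEnergy]
    linarith [hpos (fun i => u i - θ k i)]
  calc partitionSum s L κ
      ≤ ∑ S ∈ s.powerset, ∑ k, Real.exp d * Real.exp
          (∑ i ∈ S, (L + 2 * ∑ j ∈ s, θ k j * κ i j) - quadForm s κ (θ k)) := by
        refine Finset.sum_le_sum fun S hS => ?_
        obtain ⟨k, hk⟩ := hθ S (Finset.mem_powerset.1 hS)
        refine le_trans ?_ (Finset.single_le_sum (fun k _ => by positivity) (Finset.mem_univ k))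
        rw [← Real.exp_add, Real.exp_le_exp,
          hamiltonian_eq_linearize (Finset.mem_powerset.1 hS) hκ L (θ k)]
        linarith
    _ = ∑ k, Real.exp d * ∑ S ∈ s.powerset, Real.exp
          (∑ i ∈ S, (L + 2 * ∑ j ∈ s, θ k j * κ i j) - quadForm s κ (θ k)) := by
        rw [Finset.sum_comm]
        simp only [Finset.mul_sum]
    _ ≤ ∑ _k : ι, Real.exp d * Real.exp M := by
        gcongr with k
        exact hk k
    _ = Fintype.card ι * Real.exp (M + d) := by
        rw [Finset.sum_const, nsmul_eq_mul, Finset.card_univ, Real.exp_add, mul_comm (Real.exp M)]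

/-- A kernel constant in its first argument on each block annihilates `x`, so `κ'` may be subtracted
from `κ` for free. -/
theorem quadForm_le_of_fiberwise_sum_eq_zero {s : Finset ℕ} {κ : ℕ → ℕ → ℝ} {m : ℕ}
    {b : ℕ → Fin m} {κ' : Fin m → ℕ → ℝ} {δ : ℝ}
    (hκ' : ∀ i ∈ s, ∀ j ∈ s, |κ i j - κ' (b i) j| ≤ δ)
    {x : ℕ → ℝ} (hx : ∀ i ∈ s, |x i| ≤ 1)
    (hsum : ∀ k, ∑ i ∈ s with b i = k, x i = 0) :
    quadForm s κ x ≤ s.card ^ 2 * δ := by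
  have hz : ∀ j, ∑ i ∈ s, x i * κ' (b i) j = 0 := by
    intro j
    rw [← Finset.sum_fiberwise s b]
    refine Finset.sum_eq_zero fun k _ => ?_
    rw [Finset.sum_congr rfl (g := fun i => x i * κ' k j), ← Finset.sum_mul, hsum, zero_mul]
    intro i hi
    rw [(Finset.mem_filter.1 hi).2]
  have hz' : ∑ i ∈ s, ∑ j ∈ s, x i * x j * κ' (b i) j = 0 := by
    rw [Finset.sum_comm]
    refine Finset.sum_eq_zero fun j _ => ?_
    calc ∑ i ∈ s, x i * x j * κ' (b i) j = x j * ∑ i ∈ s, x i * κ' (b i) j := by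
          rw [Finset.mul_sum]; exact Finset.sum_congr rfl fun i _ => by ring
      _ = 0 := by rw [hz, mul_zero]
  calc quadForm s κ x = ∑ i ∈ s, ∑ j ∈ s, x i * x j * (κ i j - κ' (b i) j) := by
        simp only [mul_sub, Finset.sum_sub_distrib, hz', sub_zero, quadForm]
    _ ≤ ∑ _i ∈ s, ∑ _j ∈ s, δ := by
        refine Finset.sum_le_sum fun i hi => Finset.sum_le_sum fun j hj => ?_
        refine (le_abs_self _).trans ?_
        rw [abs_mul, abs_mul]
        have h1 : |x i| * |x j| ≤ 1 := mul_le_one₀ (hx i hi) (abs_nonneg _) (hx j hj)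
        calc _ ≤ 1 * |κ i j - κ' (b i) j| := by gcongr
          _ ≤ δ := by rw [one_mul]; exact hκ' i hi j hj
    _ = s.card ^ 2 * δ := by simp; ring

/-- Averaging a configuration over the blocks of a partition of the sites into `m` classes gives a
net of at most `(|s| + 1) ^ m` profiles. -/
theorem partitionSum_le_of_blocks {s : Finset ℕ} {κ : ℕ → ℕ → ℝ}
    (hκ : ∀ i j, κ i j = κ j i) (hpos : ∀ c, 0 ≤ quadForm s κ c) {L M δ : ℝ}
    (hM : ∀ u : ℕ → ℝ, (∀ i, u i ∈ Icc (0 : ℝ) 1) → meanFieldEnergy s L κ u ≤ M)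
    {m : ℕ} {b : ℕ → Fin m} {κ' : Fin m → ℕ → ℝ}
    (hκ' : ∀ i ∈ s, ∀ j ∈ s, |κ i j - κ' (b i) j| ≤ δ) :
    partitionSum s L κ ≤ (s.card + 1) ^ m * Real.exp (M + s.card ^ 2 * δ) := by
  have h := partitionSum_le_of_net hκ hpos (d := s.card ^ 2 * δ) hM
    (ι := Fin m → Fin (s.card + 1))
    (fun k i => (k (b i) : ℝ) / ({j ∈ s | b j = b i} : Finset ℕ).card) ?_
  · simpa using h
  intro S hS
  have hle : ∀ k, ({j ∈ s | b j = k ∧ j ∈ S} : Finset ℕ).card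
      ≤ ({j ∈ s | b j = k} : Finset ℕ).card := fun k =>
    Finset.card_le_card fun j hj => by
      simp only [Finset.mem_filter] at hj ⊢
      exact ⟨hj.1, hj.2.1⟩
  -- A net point is indexed by the number of occupied sites in each block; its profile is the
  -- resulting block density.
  refine ⟨fun k => ⟨({j ∈ s | b j = k ∧ j ∈ S} : Finset ℕ).card,
    Nat.lt_succ_of_le ((hle k).trans (Finset.card_filter_le _ _))⟩,
    quadForm_le_of_fiberwise_sum_eq_zero hκ' ?_ ?_⟩
  · intro i _
    have h0 : 0 ≤ (({j ∈ s | b j = b i ∧ j ∈ S} : Finset ℕ).card : ℝ)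
        / ({j ∈ s | b j = b i} : Finset ℕ).card := by positivity
    have h1 : (({j ∈ s | b j = b i ∧ j ∈ S} : Finset ℕ).card : ℝ)
        / ({j ∈ s | b j = b i} : Finset ℕ).card ≤ 1 :=
      div_le_one_of_le₀ (by exact_mod_cast hle (b i)) (by positivity)
    simp only
    rw [abs_le]
    split_ifs <;> constructor <;> linarith
  · intro k
    simp only [Finset.sum_sub_distrib]
    have h1 : ∑ i ∈ s with b i = k, (if i ∈ S then (1 : ℝ) else 0)
        = ({j ∈ s | b j = k ∧ j ∈ S} : Finset ℕ).card := by
      rw [← Finset.sum_filter, Finset.filter_filter]; simp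
    have h2 : ∑ i ∈ s with b i = k, (({j ∈ s | b j = b i ∧ j ∈ S} : Finset ℕ).card : ℝ)
        / ({j ∈ s | b j = b i} : Finset ℕ).card
        = ∑ i ∈ s with b i = k, (({j ∈ s | b j = k ∧ j ∈ S} : Finset ℕ).card : ℝ)
        / ({j ∈ s | b j = k} : Finset ℕ).card :=
      Finset.sum_congr rfl fun i hi => by rw [(Finset.mem_filter.1 hi).2]
    rw [h1, h2, Finset.sum_const, nsmul_eq_mul]
    -- An empty block has density `0 / 0 = 0`, which is harmless.
    rcases Nat.eq_zero_or_pos ({j ∈ s | b j = k} : Finset ℕ).card with h0 | h0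
    · have := hle k
      rw [h0] at this
      rw [h0, Nat.le_zero.1 this]; simp
    · rw [mul_div_cancel₀ _ (by positivity), sub_self]

/-- With `R = e^{2α}`, the exponential is `e^{-αi} e^{-αj} R^{min(i,j)}`, and `R^{min(i,j)} = 1 + ∑
(R - 1) R^k` over `k < i, k < j`. The kernel is thus a nonnegative combination of rank-one squares.
-/
theorem quadForm_exp_neg_abs_sub_nonneg (n : ℕ) {α B : ℝ} (hα : 0 ≤ α) (hB : 0 ≤ B) (c : ℕ → ℝ) :
    0 ≤ quadForm (Finset.range n) (fun i j => B * Real.exp (-(α * |(i : ℝ) - j|))) c := by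
  set R : ℝ := Real.exp (2 * α) with hR
  have hR1 : 1 ≤ R := Real.one_le_exp (by positivity)
  set e : ℕ → ℝ := fun i => c i * Real.exp (-(α * i)) with he
  have key : ∀ i ∈ Finset.range n, ∀ j ∈ Finset.range n,
      c i * c j * (B * Real.exp (-(α * |(i : ℝ) - j|)))
        = B * (e i * e j) + ∑ k ∈ Finset.range n, B * ((R - 1) * R ^ k) *
          ((if k < i then e i else 0) * (if k < j then e j else 0)) := by
    intro i hi j hj
    have h1 : ∑ k ∈ Finset.range n, B * ((R - 1) * R ^ k) *
          ((if k < i then e i else 0) * (if k < j then e j else 0))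
        = B * (e i * e j) * (R ^ min i j - 1) := by
      rw [← geom_sum_mul, Finset.sum_mul, Finset.mul_sum]
      have hsub : Finset.range (min i j) ⊆ Finset.range n := by
        intro k hk
        simp only [Finset.mem_range] at *
        omega
      rw [← Finset.sum_subset hsub]
      · refine Finset.sum_congr rfl fun k hk => ?_
        simp only [Finset.mem_range, lt_min_iff] at hk
        rw [if_pos hk.1, if_pos hk.2]; ring
      · intro k _ hk
        simp only [Finset.mem_range, lt_min_iff, not_and_or] at hk
        rcases hk with hk | hk <;> simp [hk]
    rw [h1]
    have h2 : Real.exp (-(α * |(i : ℝ) - j|))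
        = Real.exp (-(α * i)) * Real.exp (-(α * j)) * R ^ min i j := by
      rw [hR, ← Real.exp_nat_mul, ← Real.exp_add, ← Real.exp_add]
      congr 1
      rcases le_total i j with h | h
      · have h' : (i : ℝ) ≤ j := by exact_mod_cast h
        rw [min_eq_left h, abs_of_nonpos (by linarith)]; ring
      · have h' : (j : ℝ) ≤ i := by exact_mod_cast h
        rw [min_eq_right h, abs_of_nonneg (by linarith)]; ring
    rw [h2, he]; ring
  have hsq : ∀ f : ℕ → ℝ, 0 ≤ ∑ i ∈ Finset.range n, ∑ j ∈ Finset.range n, f i * f j := by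
    intro f
    rw [← Finset.sum_mul_sum]
    exact mul_self_nonneg _
  calc 0 ≤ B * ∑ i ∈ Finset.range n, ∑ j ∈ Finset.range n, e i * e j
        + ∑ k ∈ Finset.range n, B * ((R - 1) * R ^ k) * ∑ i ∈ Finset.range n,
          ∑ j ∈ Finset.range n, (if k < i then e i else 0) * (if k < j then e j else 0) := by
        refine add_nonneg (mul_nonneg hB (hsq _)) (Finset.sum_nonneg fun k _ => ?_)
        refine mul_nonneg (mul_nonneg hB (mul_nonneg (by linarith) (by positivity))) (hsq _)
    _ = _ := by
        rw [quadForm, Finset.sum_congr rfl fun i hi => Finset.sum_congr rfl fun j hj => key i hi j hj]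
        simp only [Finset.sum_add_distrib, Finset.mul_sum]
        congr 1
        rw [Finset.sum_comm]
        refine Finset.sum_congr rfl fun i _ => ?_
        rw [Finset.sum_comm]

end LatticeGas

/-! ### Discretising the variational problem -/

section Continuum

theorem entropyFn_eq_neg_binEntropy (x : ℝ) : entropyFn x = -Real.binEntropy x := by
  rw [entropyFn, Real.binEntropy, Real.log_inv, Real.log_inv]; ring

theorem continuous_entropyFn : Continuous entropyFn := by
  rw [show entropyFn = fun x => -Real.binEntropy x from funext entropyFn_eq_neg_binEntropy]
  exact Real.binEntropy_continuous.neg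

theorem convexOn_entropyFn : ConvexOn ℝ (Icc 0 1) entropyFn := by
  rw [show entropyFn = -Real.binEntropy from funext entropyFn_eq_neg_binEntropy]
  exact Real.strictConcave_binEntropy.concaveOn.neg

theorem abs_exp_neg_sub_exp_neg_le {u v : ℝ} (hu : 0 ≤ u) (hv : 0 ≤ v) :
    |Real.exp (-u) - Real.exp (-v)| ≤ |u - v| := by
  wlog h : u ≤ v generalizing u v
  · rw [abs_sub_comm, abs_sub_comm u v]
    exact this hv hu (le_of_not_ge h)
  have h1 : Real.exp (-v) = Real.exp (-u) * Real.exp (-(v - u)) := by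
    rw [← Real.exp_add]; congr 1; ring
  have h2 : 1 - (v - u) ≤ Real.exp (-(v - u)) := by
    linarith [Real.add_one_le_exp (-(v - u))]
  have h3 : Real.exp (-u) ≤ 1 := Real.exp_le_one_iff.2 (by linarith)
  have h4 : Real.exp (-v) ≤ Real.exp (-u) := Real.exp_le_exp.2 (by linarith)
  rw [abs_of_nonneg (by linarith), abs_of_nonpos (by linarith), h1]
  nlinarith [Real.exp_pos (-u)]

theorem interactionKernel_comm (a y z : ℝ) :
    interactionKernel a y z = interactionKernel a z y := by
  rw [interactionKernel, interactionKernel, abs_sub_comm]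

/-- The prefactor `1/(2a)` cancels the Lipschitz constant `a` of the exponential. -/
theorem abs_interactionKernel_sub_le {a : ℝ} (ha : 0 < a) (y y' z : ℝ) :
    |interactionKernel a y z - interactionKernel a y' z| ≤ 1 / 2 * |y - y'| := by
  rw [interactionKernel, interactionKernel, ← mul_sub, abs_mul, abs_of_pos (by positivity),
    neg_mul, neg_mul]
  have h := abs_exp_neg_sub_exp_neg_le (u := a * |y - z|) (v := a * |y' - z|)
    (by positivity) (by positivity)
  have h2 : abs (a * |y - z| - a * |y' - z|) ≤ a * |y - y'| := by
    rw [← mul_sub, abs_mul, abs_of_pos ha]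
    have := abs_abs_sub_abs_le_abs_sub (y - z) (y' - z)
    rw [sub_sub_sub_cancel_right] at this
    gcongr
  calc _ ≤ 1 / (2 * a) * (a * |y - y'|) := by gcongr; exact h.trans h2
    _ = _ := by field_simp

theorem div_mem_Icc_zero_one {n k : ℕ} (hk : k ≤ n) : (k : ℝ) / n ∈ Icc (0 : ℝ) 1 :=
  ⟨by positivity, div_le_one_of_le₀ (by exact_mod_cast hk) (by positivity)⟩

theorem uIoc_cell_subset {n i : ℕ} (hi : i < n) :
    uIoc ((i : ℝ) / n) (((i + 1 : ℕ) : ℝ) / n) ⊆ Icc 0 1 := by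
  rw [uIoc_of_le (by gcongr; simp)]
  exact fun x hx => ⟨(div_mem_Icc_zero_one hi.le).1.trans hx.1.le,
    hx.2.trans (div_mem_Icc_zero_one hi).2⟩

theorem intervalIntegrable_cell {f : ℝ → ℝ} (hf : IntervalIntegrable f volume 0 1) {n i : ℕ}
    (hi : i < n) :
    IntervalIntegrable f volume ((i : ℝ) / n) (((i + 1 : ℕ) : ℝ) / n) := by
  refine hf.mono_set ?_
  rw [uIcc_of_le zero_le_one]
  exact uIcc_subset_Icc (div_mem_Icc_zero_one hi.le) (div_mem_Icc_zero_one hi)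

theorem integral_eq_sum_cells {f : ℝ → ℝ} (hf : IntervalIntegrable f volume 0 1) {n : ℕ}
    (hn : 0 < n) :
    ∫ x in (0 : ℝ)..1, f x
      = ∑ i ∈ Finset.range n, ∫ x in ((i : ℝ) / n)..(((i + 1 : ℕ) : ℝ) / n), f x := by
  rw [intervalIntegral.sum_integral_adjacent_intervals (a := fun k : ℕ => (k : ℝ) / n)
    fun k hk => intervalIntegrable_cell hf hk]
  have : (n : ℝ) ≠ 0 := by positivity
  simp [this]

theorem cell_length {n : ℕ} (i : ℕ) (hn : 0 < n) :
    ((i + 1 : ℕ) : ℝ) / n - (i : ℝ) / n = 1 / n := by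
  push_cast; field_simp; ring

theorem intervalIntegrable_comp_of_mem_Icc {f h : ℝ → ℝ} (hfm : Measurable f)
    (hf : ∀ᵐ x, x ∈ Icc (0 : ℝ) 1 → f x ∈ Icc (0 : ℝ) 1) (hh : Continuous h) :
    IntervalIntegrable (fun x => h (f x)) volume 0 1 := by
  obtain ⟨C, hC⟩ := (isCompact_Icc (a := (0 : ℝ)) (b := 1)).exists_bound_of_continuousOn
    hh.continuousOn
  rw [intervalIntegrable_iff_integrableOn_Icc_of_le zero_le_one]
  refine Measure.integrableOn_of_bounded (M := C) (by simp)
    (hh.measurable.comp hfm).aestronglyMeasurable ?_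
  rw [ae_restrict_iff' measurableSet_Icc]
  filter_upwards [hf] with x hx hx1 using hC _ (hx hx1)

variable {f : ℝ → ℝ}

theorem abs_integral_mul_sub_sum_cells_le (hfi : IntervalIntegrable f volume 0 1)
    (hf : ∀ᵐ x, x ∈ Icc (0 : ℝ) 1 → f x ∈ Icc (0 : ℝ) 1) {φ : ℝ → ℝ}
    (hφ : ∀ x y, |φ x - φ y| ≤ 1 / 2 * |x - y|) {n : ℕ} (hn : 0 < n) :
    |(∫ x in (0 : ℝ)..1, f x * φ x) - ∑ i ∈ Finset.range n,
      (∫ x in ((i : ℝ) / n)..(((i + 1 : ℕ) : ℝ) / n), f x) * φ (i / n)| ≤ 1 / (2 * n) := by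
  have hφc : Continuous φ :=
    (LipschitzWith.of_dist_le_mul (K := 1 / 2) fun x y => by
      simpa [Real.dist_eq] using hφ x y).continuous
  have hmul : ∀ c : ℝ, IntervalIntegrable (fun x => f x * (φ x - c)) volume 0 1 := fun c =>
    hfi.mul_continuousOn (by fun_prop)
  have hmul0 := hfi.mul_continuousOn (hφc.continuousOn (s := uIcc 0 1))
  rw [integral_eq_sum_cells hmul0 hn, ← Finset.sum_sub_distrib]
  have hcell : ∀ i ∈ Finset.range n,
      |(∫ x in ((i : ℝ) / n)..(((i + 1 : ℕ) : ℝ) / n), f x * φ x)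
        - (∫ x in ((i : ℝ) / n)..(((i + 1 : ℕ) : ℝ) / n), f x) * φ (i / n)|
      ≤ 1 / (2 * n) * (1 / n) := by
    intro i hi
    have hi := Finset.mem_range.1 hi
    rw [← intervalIntegral.integral_mul_const, ← intervalIntegral.integral_sub
      (intervalIntegrable_cell hmul0 hi) ((intervalIntegrable_cell hfi hi).mul_const _),
      ← Real.norm_eq_abs]
    refine (intervalIntegral.norm_integral_le_of_norm_le_const_ae (C := 1 / (2 * n)) ?_).trans_eq ?_
    · filter_upwards [hf] with x hx hxi
      have hx1 := hx (uIoc_cell_subset hi hxi)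
      rw [uIoc_of_le (by gcongr; simp)] at hxi
      rw [← mul_sub, norm_mul, Real.norm_eq_abs, Real.norm_eq_abs, abs_of_nonneg hx1.1]
      have h1 : |x - (i : ℝ) / n| ≤ 1 / n := by
        rw [abs_of_nonneg (by linarith [hxi.1]), ← cell_length i hn]
        linarith [hxi.2]
      calc f x * |φ x - φ (i / n)| ≤ 1 * (1 / 2 * (1 / n)) := by
            refine mul_le_mul hx1.2 ((hφ _ _).trans ?_) (abs_nonneg _) zero_le_one
            gcongr
        _ = _ := by ring
    · rw [cell_length i hn, abs_of_nonneg (by positivity)]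
  calc _ ≤ ∑ i ∈ Finset.range n, 1 / (2 * (n : ℝ)) * (1 / n) :=
        (Finset.abs_sum_le_sum_abs _ _).trans (Finset.sum_le_sum hcell)
    _ = _ := by simp; field_simp

theorem abs_integral_kernel_sub_le (hfi : IntervalIntegrable f volume 0 1)
    (hf : ∀ᵐ x, x ∈ Icc (0 : ℝ) 1 → f x ∈ Icc (0 : ℝ) 1) {a : ℝ} (ha : 0 < a) (y y' : ℝ) :
    |(∫ z in (0 : ℝ)..1, f z * interactionKernel a y z)
      - ∫ z in (0 : ℝ)..1, f z * interactionKernel a y' z| ≤ 1 / 2 * |y - y'| := by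
  have hc : ∀ y, Continuous (interactionKernel a y) := fun y => by
    unfold interactionKernel; fun_prop
  rw [← intervalIntegral.integral_sub (hfi.mul_continuousOn (hc _).continuousOn)
    (hfi.mul_continuousOn (hc _).continuousOn), ← Real.norm_eq_abs]
  refine (intervalIntegral.norm_integral_le_of_norm_le_const_ae (C := 1 / 2 * |y - y'|)
    ?_).trans_eq (by simp)
  filter_upwards [hf] with x hx hxi
  rw [uIoc_of_le zero_le_one] at hxi
  have hx1 := hx ⟨hxi.1.le, hxi.2⟩
  rw [← mul_sub, norm_mul, Real.norm_eq_abs, Real.norm_eq_abs, abs_of_nonneg hx1.1]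
  calc _ ≤ 1 * (1 / 2 * |y - y'|) :=
        mul_le_mul hx1.2 (abs_interactionKernel_sub_le ha _ _ _) (abs_nonneg _) zero_le_one
    _ = _ := one_mul _

/-- The variables are discretised one at a time. The inner integral is again `1/2`-Lipschitz in `y`,
so the one-variable estimate applies twice, at cost `1/(2n)` each. -/
theorem abs_double_integral_sub_sum_cells_le (hfi : IntervalIntegrable f volume 0 1)
    (hf : ∀ᵐ x, x ∈ Icc (0 : ℝ) 1 → f x ∈ Icc (0 : ℝ) 1) {a : ℝ} (ha : 0 < a) {n : ℕ}
    (hn : 0 < n) {c : ℕ → ℝ}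
    (hc : ∀ i < n, c i = ∫ x in ((i : ℝ) / n)..(((i + 1 : ℕ) : ℝ) / n), f x) :
    |(∫ y in (0 : ℝ)..1, ∫ z in (0 : ℝ)..1, f y * f z * interactionKernel a y z)
      - ∑ i ∈ Finset.range n, ∑ j ∈ Finset.range n,
        c i * c j * interactionKernel a (i / n) (j / n)| ≤ 1 / n := by
  set G : ℝ → ℝ := fun y => ∫ z in (0 : ℝ)..1, f z * interactionKernel a y z with hG
  have h1 : (∫ y in (0 : ℝ)..1, ∫ z in (0 : ℝ)..1, f y * f z * interactionKernel a y z)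
      = ∫ y in (0 : ℝ)..1, f y * G y := by
    simp only [hG, mul_assoc, intervalIntegral.integral_const_mul]
  have h2 := abs_integral_mul_sub_sum_cells_le hfi hf (abs_integral_kernel_sub_le hfi hf ha) hn
  have h3 : ∀ y, |G y - ∑ j ∈ Finset.range n, c j * interactionKernel a y (j / n)|
      ≤ 1 / (2 * n) := by
    intro y
    have := abs_integral_mul_sub_sum_cells_le hfi hf (φ := interactionKernel a y)
      (fun z z' => by
        rw [interactionKernel_comm a y z, interactionKernel_comm a y z']
        exact abs_interactionKernel_sub_le ha z z' y) hn
    rwa [Finset.sum_congr rfl fun j hj => by rw [← hc j (Finset.mem_range.1 hj)]] at this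
  rw [Finset.sum_congr rfl fun j hj => by rw [← hc j (Finset.mem_range.1 hj)]] at h2
  have hci : ∀ i ∈ Finset.range n, |c i| ≤ 1 / n := by
    intro i hi
    have hi := Finset.mem_range.1 hi
    rw [hc i hi, ← Real.norm_eq_abs]
    refine (intervalIntegral.norm_integral_le_of_norm_le_const_ae (C := 1) ?_).trans_eq ?_
    · filter_upwards [hf] with x hx hxi
      have hx1 := hx (uIoc_cell_subset hi hxi)
      rw [Real.norm_eq_abs, abs_of_nonneg hx1.1]; exact hx1.2
    · rw [cell_length i hn, abs_of_nonneg (by positivity), one_mul]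
  have h4 : |∑ i ∈ Finset.range n, c i * G (i / n) - ∑ i ∈ Finset.range n, ∑ j ∈ Finset.range n,
      c i * c j * interactionKernel a (i / n) (j / n)| ≤ 1 / (2 * n) := by
    rw [← Finset.sum_sub_distrib]
    calc _ ≤ ∑ i ∈ Finset.range n, 1 / (n : ℝ) * (1 / (2 * n)) := by
          refine (Finset.abs_sum_le_sum_abs _ _).trans (Finset.sum_le_sum fun i hi => ?_)
          simp only [mul_assoc, ← Finset.mul_sum]
          rw [← mul_sub, abs_mul]
          exact mul_le_mul (hci i hi) (h3 _) (abs_nonneg _) (by positivity)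
      _ = _ := by simp; field_simp
  rw [h1]
  calc _ ≤ 1 / (2 * (n : ℝ)) + 1 / (2 * n) := (abs_sub_le _ _ _).trans (add_le_add h2 h4)
    _ = 1 / n := by ring

theorem entropyFn_cell_average_le (hfm : Measurable f)
    (hf : ∀ᵐ x, x ∈ Icc (0 : ℝ) 1 → f x ∈ Icc (0 : ℝ) 1) {n i : ℕ} (hi : i < n) :
    n * (∫ x in ((i : ℝ) / n)..(((i + 1 : ℕ) : ℝ) / n), f x) ∈ Icc (0 : ℝ) 1 ∧
    entropyFn (n * ∫ x in ((i : ℝ) / n)..(((i + 1 : ℕ) : ℝ) / n), f x)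
      ≤ n * ∫ x in ((i : ℝ) / n)..(((i + 1 : ℕ) : ℝ) / n), entropyFn (f x) := by
  have hn : 0 < n := by omega
  have hle : (i : ℝ) / n ≤ ((i + 1 : ℕ) : ℝ) / n := by gcongr; simp
  have hae : ∀ᵐ x ∂volume.restrict (uIoc ((i : ℝ) / n) (((i + 1 : ℕ) : ℝ) / n)),
      f x ∈ Icc (0 : ℝ) 1 := by
    rw [ae_restrict_iff' measurableSet_uIoc]
    filter_upwards [hf] with x hx hxi using hx (uIoc_cell_subset hi hxi)
  have hvol : volume (uIoc ((i : ℝ) / n) (((i + 1 : ℕ) : ℝ) / n)) = ENNReal.ofReal (1 / n) := by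
    rw [uIoc_of_le hle, Real.volume_Ioc, cell_length i hn]
  have h0 : volume (uIoc ((i : ℝ) / n) (((i + 1 : ℕ) : ℝ) / n)) ≠ 0 := by
    rw [hvol]; simp [hn]
  have htop : volume (uIoc ((i : ℝ) / n) (((i + 1 : ℕ) : ℝ) / n)) ≠ ⊤ := by rw [hvol]; simp
  have hi1 := (intervalIntegrable_iff.1 (intervalIntegrable_cell
    (intervalIntegrable_comp_of_mem_Icc hfm hf continuous_id) hi))
  have hi2 := (intervalIntegrable_iff.1 (intervalIntegrable_cell
    (intervalIntegrable_comp_of_mem_Icc hfm hf continuous_entropyFn) hi))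
  have havg : ∀ h : ℝ → ℝ, (⨍ x in uIoc ((i : ℝ) / n) (((i + 1 : ℕ) : ℝ) / n), h x)
      = n * ∫ x in ((i : ℝ) / n)..(((i + 1 : ℕ) : ℝ) / n), h x := by
    intro h
    rw [interval_average_eq, cell_length i hn, smul_eq_mul, one_div, inv_inv]
  have hconv := convexOn_entropyFn.map_set_average_le continuous_entropyFn.continuousOn isClosed_Icc
    h0 htop hae hi1 hi2
  have hmem := (convex_Icc (0 : ℝ) 1).set_average_mem isClosed_Icc h0 htop hae hi1
  rw [havg] at hmem
  rw [havg, havg] at hconv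
  exact ⟨hmem, hconv⟩

/-- The discretisation of the interaction kernel at the points `i / n`. -/
noncomputable def siteKernel (β a : ℝ) (n : ℕ) (i j : ℕ) : ℝ :=
  β / n * interactionKernel a (i / n) (j / n)

theorem deriv_mem_Icc_of_mem_admissibleSet {g : ℝ → ℝ} (hg : g ∈ admissibleSet) :
    ∀ᵐ x, x ∈ Icc (0 : ℝ) 1 → deriv g x ∈ Icc (0 : ℝ) 1 :=
  (ae_restrict_iff' measurableSet_Icc).1 hg.2.2.2

theorem abs_interaction_sub_quadForm_le {β a : ℝ} (hβ : 0 ≤ β) (ha : 0 < a) {g : ℝ → ℝ}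
    (hg : g ∈ admissibleSet) {n : ℕ} (hn : 0 < n) {θ : ℕ → ℝ}
    (hθ : ∀ i < n, θ i = n * ∫ x in ((i : ℝ) / n)..(((i + 1 : ℕ) : ℝ) / n), deriv g x) :
    |β * (∫ y in (0 : ℝ)..1, ∫ z in (0 : ℝ)..1, deriv g y * deriv g z * interactionKernel a y z)
      - 1 / n * quadForm (Finset.range n) (siteKernel β a n) θ| ≤ β / n := by
  have h := abs_double_integral_sub_sum_cells_le hg.2.2.1.intervalIntegrable_deriv
    (deriv_mem_Icc_of_mem_admissibleSet hg) ha hn (c := fun i => θ i / n)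
    (fun i hi => by rw [hθ i hi]; field_simp)
  have h2 : 1 / n * quadForm (Finset.range n) (siteKernel β a n) θ
      = β * ∑ i ∈ Finset.range n, ∑ j ∈ Finset.range n,
        θ i / n * (θ j / n) * interactionKernel a (i / n) (j / n) := by
    simp only [quadForm, Finset.mul_sum, siteKernel]
    refine Finset.sum_congr rfl fun i _ => Finset.sum_congr rfl fun j _ => by ring
  rw [h2, ← mul_sub, abs_mul, abs_of_nonneg hβ]
  calc _ ≤ β * (1 / n) := by gcongr
    _ = _ := by ring

theorem eval_one_eq_sum_cells {g : ℝ → ℝ} (hg : g ∈ admissibleSet) {n : ℕ} (hn : 0 < n)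
    {θ : ℕ → ℝ}
    (hθ : ∀ i < n, θ i = n * ∫ x in ((i : ℝ) / n)..(((i + 1 : ℕ) : ℝ) / n), deriv g x) :
    g 1 = 1 / n * ∑ i ∈ Finset.range n, θ i := by
  have h := hg.2.2.1.integral_deriv_eq_sub
  rw [hg.2.1, sub_zero, integral_eq_sum_cells hg.2.2.1.intervalIntegrable_deriv hn] at h
  rw [← h, Finset.mul_sum]
  refine Finset.sum_congr rfl fun i hi => ?_
  rw [hθ i (Finset.mem_range.1 hi)]
  field_simp

/-- Averaging `g'` over cells preserves `g 1`, moves the interaction by at most `β/n`, and by Jensen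
does not raise the entropy term. -/
theorem exists_rateFunctional_le_meanFieldEnergy (ρ : ℝ) {β a : ℝ} (hβ : 0 ≤ β) (ha : 0 < a)
    {g : ℝ → ℝ} (hg : g ∈ admissibleSet) {n : ℕ} (hn : 0 < n) :
    ∃ θ : ℕ → ℝ, (∀ i, θ i ∈ Icc (0 : ℝ) 1) ∧ rateFunctional ρ β a g ≤
      1 / n * meanFieldEnergy (Finset.range n) (Real.log ρ) (siteKernel β a n) θ + β / n := by
  have hmem := deriv_mem_Icc_of_mem_admissibleSet hg
  have hm := measurable_deriv g
  set θ : ℕ → ℝ := fun i => if i < n then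
    n * ∫ x in ((i : ℝ) / n)..(((i + 1 : ℕ) : ℝ) / n), deriv g x else 0 with hθdef
  have hθ : ∀ i < n, θ i = n * ∫ x in ((i : ℝ) / n)..(((i + 1 : ℕ) : ℝ) / n), deriv g x :=
    fun i hi => if_pos hi
  refine ⟨θ, fun i => ?_, ?_⟩
  · by_cases hi : i < n
    · rw [hθ i hi]; exact (entropyFn_cell_average_le hm hmem hi).1
    · simp [hθdef, hi]
  have h1 := (abs_le.1 (abs_interaction_sub_quadForm_le hβ ha hg hn hθ)).2
  have h2 := eval_one_eq_sum_cells hg hn hθ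
  have h3 : 1 / n * ∑ i ∈ Finset.range n, entropyFn (θ i)
      ≤ ∫ x in (0 : ℝ)..1, entropyFn (deriv g x) := by
    rw [integral_eq_sum_cells (intervalIntegrable_comp_of_mem_Icc hm hmem continuous_entropyFn) hn,
      Finset.mul_sum]
    refine Finset.sum_le_sum fun i hi => ?_
    have hi := Finset.mem_range.1 hi
    rw [hθ i hi, one_div, inv_mul_le_iff₀ (by positivity)]
    exact (entropyFn_cell_average_le hm hmem hi).2
  rw [rateFunctional, meanFieldEnergy, Finset.sum_sub_distrib, ← Finset.mul_sum, h2, mul_add,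
    mul_sub]
  linarith

/-- The function with slope `θ i` on the cell `[i / n, (i + 1) / n)`. -/
noncomputable def stepPrimitive (n : ℕ) (θ : ℕ → ℝ) (x : ℝ) : ℝ :=
  ∫ t in (0 : ℝ)..x, θ ⌊(n : ℝ) * t⌋₊

theorem measurable_stepFn (n : ℕ) (θ : ℕ → ℝ) : Measurable fun t : ℝ => θ ⌊(n : ℝ) * t⌋₊ :=
  (measurable_from_top (f := θ)).comp (Nat.measurable_floor.comp (measurable_const_mul _))

theorem intervalIntegrable_stepFn (n : ℕ) {θ : ℕ → ℝ} (hθ : ∀ i, θ i ∈ Icc (0 : ℝ) 1) (x y : ℝ) :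
    IntervalIntegrable (fun t : ℝ => θ ⌊(n : ℝ) * t⌋₊) volume x y := by
  rw [intervalIntegrable_iff]
  refine Measure.integrableOn_of_bounded (M := 1) (by simp [uIoc])
    (measurable_stepFn n θ).aestronglyMeasurable (Eventually.of_forall fun t => ?_)
  rw [Real.norm_eq_abs, abs_of_nonneg (hθ _).1]
  exact (hθ _).2

theorem ae_deriv_stepPrimitive (n : ℕ) {θ : ℕ → ℝ} (hθ : ∀ i, θ i ∈ Icc (0 : ℝ) 1) :
    ∀ᵐ x, deriv (stepPrimitive n θ) x = θ ⌊(n : ℝ) * x⌋₊ := by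
  have h : LocallyIntegrable (fun t : ℝ => θ ⌊(n : ℝ) * t⌋₊) volume := by
    refine (locallyIntegrable_const (1 : ℝ)).mono (measurable_stepFn n θ).aestronglyMeasurable
      (Eventually.of_forall fun t => ?_)
    rw [Real.norm_eq_abs, abs_of_nonneg (hθ _).1]
    simpa using (hθ _).2
  filter_upwards [_root_.LocallyIntegrable.ae_hasDerivAt_integral h] with x hx
  exact (hx 0).deriv

theorem stepPrimitive_mem_admissibleSet (n : ℕ) {θ : ℕ → ℝ} (hθ : ∀ i, θ i ∈ Icc (0 : ℝ) 1) :
    stepPrimitive n θ ∈ admissibleSet := by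
  refine ⟨fun x hx => ⟨?_, ?_⟩, by simp [stepPrimitive], ?_, ?_⟩
  · exact intervalIntegral.integral_nonneg hx.1 fun t _ => (hθ _).1
  · calc stepPrimitive n θ x ≤ ∫ t in (0 : ℝ)..x, (1 : ℝ) :=
          intervalIntegral.integral_mono_on hx.1 (intervalIntegrable_stepFn n hθ _ _) (by simp)
            fun t _ => (hθ _).2
      _ ≤ 1 := by simpa using hx.2
  · exact (intervalIntegrable_stepFn n hθ 0 1).absolutelyContinuousOnInterval_intervalIntegral
      (by simp)
  · refine ae_restrict_of_ae ?_
    filter_upwards [ae_deriv_stepPrimitive n hθ] with x hx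
    rw [hx]
    exact hθ _

theorem integral_cell_comp_deriv_stepPrimitive {n : ℕ} {θ : ℕ → ℝ}
    (hθ : ∀ i, θ i ∈ Icc (0 : ℝ) 1) (h : ℝ → ℝ) {i : ℕ} (hi : i < n) :
    ∫ x in ((i : ℝ) / n)..(((i + 1 : ℕ) : ℝ) / n), h (deriv (stepPrimitive n θ) x)
      = 1 / n * h (θ i) := by
  have hn : 0 < n := by omega
  rw [intervalIntegral.integral_congr_ae (g := fun _ => h (θ i)), intervalIntegral.integral_const,
    cell_length i hn, smul_eq_mul]
  -- Interval integrals use cells closed on the right, but at the right endpoint the floor is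
  -- already `i + 1`.
  have hne : ∀ᵐ x : ℝ, x ≠ ((i + 1 : ℕ) : ℝ) / n := by simp [ae_iff]
  filter_upwards [ae_deriv_stepPrimitive n hθ, hne] with x hx hx1 hxi
  rw [uIoc_of_le (by gcongr; simp)] at hxi
  have hn' : (0 : ℝ) < n := by exact_mod_cast hn
  have h1 : (i : ℝ) ≤ n * x := by
    have := hxi.1.le
    rwa [div_le_iff₀' hn'] at this
  have h2 : (n : ℝ) * x < i + 1 := by
    have := lt_of_le_of_ne hxi.2 hx1
    rw [lt_div_iff₀' hn'] at this
    exact_mod_cast this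
  rw [hx, (Nat.floor_eq_iff (by linarith [Nat.cast_nonneg (α := ℝ) i])).2 ⟨h1, h2⟩]

/-- For a step profile the entropy and linear terms agree exactly; only the kernel is discretised.
-/
theorem meanFieldEnergy_le_rateFunctional_stepPrimitive (ρ : ℝ) {β a : ℝ} (hβ : 0 ≤ β)
    (ha : 0 < a) {n : ℕ} (hn : 0 < n) {θ : ℕ → ℝ} (hθ : ∀ i, θ i ∈ Icc (0 : ℝ) 1) :
    1 / n * meanFieldEnergy (Finset.range n) (Real.log ρ) (siteKernel β a n) θ
      ≤ rateFunctional ρ β a (stepPrimitive n θ) + β / n := by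
  have hg := stepPrimitive_mem_admissibleSet n hθ
  have hcell : ∀ i < n, θ i
      = n * ∫ x in ((i : ℝ) / n)..(((i + 1 : ℕ) : ℝ) / n), deriv (stepPrimitive n θ) x := by
    intro i hi
    rw [integral_cell_comp_deriv_stepPrimitive hθ (fun y => y) hi]
    field_simp
  have h1 := (abs_le.1 (abs_interaction_sub_quadForm_le hβ ha hg hn hcell)).1
  have h2 := eval_one_eq_sum_cells hg hn hcell
  have h3 : ∫ x in (0 : ℝ)..1, entropyFn (deriv (stepPrimitive n θ) x)
      = 1 / n * ∑ i ∈ Finset.range n, entropyFn (θ i) := by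
    rw [integral_eq_sum_cells (intervalIntegrable_comp_of_mem_Icc (measurable_deriv _)
      (deriv_mem_Icc_of_mem_admissibleSet hg) continuous_entropyFn) hn, Finset.mul_sum]
    exact Finset.sum_congr rfl fun i hi =>
      integral_cell_comp_deriv_stepPrimitive hθ _ (Finset.mem_range.1 hi)
  rw [rateFunctional, meanFieldEnergy, Finset.sum_sub_distrib, ← Finset.mul_sum, h2, h3, mul_add,
    mul_sub]
  linarith

end Continuum

/-! ### Gaussian law of the sampled Ornstein-Uhlenbeck process and the first moment -/

section OrnsteinUhlenbeck

/-- The Riemann-Stieltjes sum of `exp (γ s)` against a path `w` over the first `m` cells of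
length `δ`. -/
noncomputable def expStieltjesSum (γ δ : ℝ) (m : ℕ) (w : ℝ≥0 → ℝ) : ℝ :=
  ∑ k ∈ Finset.range m, Real.exp (γ * (k * δ)) *
    (w (Real.toNNReal ((k + 1 : ℕ) * δ)) - w (Real.toNNReal (k * δ)))

theorem abs_langevin_cell_error_le {ζ : ℝ → ℝ} (hζ : Continuous ζ) {γ δ C ε s : ℝ} (hγ : 0 < γ)
    (hδ : 0 < δ) (hγδ : γ * δ ≤ 1) (hC : |ζ (s + δ)| ≤ C)
    (hε : ∀ r ∈ Icc s (s + δ), |ζ (s + δ) - ζ r| ≤ ε) :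
    |(Real.exp (γ * δ) - 1) * ζ (s + δ) - γ * ∫ r in s..(s + δ), ζ r|
      ≤ δ * (γ * ε + γ ^ 2 * δ * C) := by
  have h1 : |∫ r in s..(s + δ), (ζ (s + δ) - ζ r)| ≤ ε * δ := by
    have h := intervalIntegral.norm_integral_le_of_norm_le_const (a := s) (b := s + δ) (C := ε)
      (f := fun r => ζ (s + δ) - ζ r) fun r hr => by
        rw [uIoc_of_le (by linarith)] at hr
        exact hε r ⟨hr.1.le, hr.2⟩
    rwa [add_sub_cancel_left, abs_of_pos hδ] at h
  have h2 : (∫ r in s..(s + δ), (ζ (s + δ) - ζ r))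
      = δ * ζ (s + δ) - ∫ r in s..(s + δ), ζ r := by
    rw [intervalIntegral.integral_sub (by simp) (hζ.intervalIntegrable _ _)]
    simp
  have h3 : |Real.exp (γ * δ) - 1 - γ * δ| ≤ (γ * δ) ^ 2 := by
    refine Real.abs_exp_sub_one_sub_id_le ?_
    rwa [abs_of_pos (by positivity)]
  calc _ = |(Real.exp (γ * δ) - 1 - γ * δ) * ζ (s + δ)
        + γ * ∫ r in s..(s + δ), (ζ (s + δ) - ζ r)| := by rw [h2]; congr 1; ring
    _ ≤ (γ * δ) ^ 2 * C + γ * (ε * δ) := by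
        refine (abs_add_le _ _).trans (add_le_add ?_ ?_)
        · rw [abs_mul]; gcongr
        · rw [abs_mul, abs_of_pos hγ]; gcongr
    _ = _ := by ring

/-- This is `d(e^{γt} z) = σ e^{γt} dw` in summed form. After telescoping, each cell leaves the
error of `abs_langevin_cell_error_le`, which is `o(δ)` uniformly because `z` is uniformly continuous
on the compact interval. -/
theorem tendsto_expStieltjesSum {z w : ℝ≥0 → ℝ} (hz : Continuous z) {γ σ τ : ℝ} (hγ : 0 < γ)
    (hτ : 0 < τ)
    (hsde : ∀ t : ℝ≥0, z t = z 0 - γ * (∫ s in (0 : ℝ)..(t : ℝ), z (Real.toNNReal s)) + σ * w t)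
    (i : ℕ) :
    Tendsto (fun N : ℕ => σ * expStieltjesSum γ (τ / N) (N * i) w) atTop
      (𝓝 (Real.exp (γ * (i * τ)) * z (Real.toNNReal (i * τ)) - z 0)) := by
  set ζ : ℝ → ℝ := fun s => z (Real.toNNReal s) with hζdef
  have hζ : Continuous ζ := hz.comp continuous_real_toNNReal
  set T : ℝ := i * τ with hT
  have hT0 : 0 ≤ T := by positivity
  obtain ⟨C, hC⟩ := (isCompact_Icc (a := 0) (b := T)).exists_bound_of_continuousOn hζ.continuousOn
  have huc := (isCompact_Icc (a := 0) (b := T)).uniformContinuousOn_of_continuous hζ.continuousOn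
  rw [Metric.uniformContinuousOn_iff] at huc
  have hincr : ∀ s δ : ℝ, 0 ≤ s → 0 ≤ δ → ζ (s + δ) - ζ s
      = -γ * (∫ r in s..(s + δ), ζ r)
        + σ * (w (Real.toNNReal (s + δ)) - w (Real.toNNReal s)) := by
    intro s δ hs hδ
    have h1 := hsde (Real.toNNReal (s + δ))
    have h2 := hsde (Real.toNNReal s)
    rw [Real.coe_toNNReal _ (by positivity)] at h1
    rw [Real.coe_toNNReal _ hs] at h2
    have h3 := intervalIntegral.integral_add_adjacent_intervals (hζ.intervalIntegrable 0 s)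
      (hζ.intervalIntegrable (μ := volume) s (s + δ))
    simp only [hζdef] at h3 ⊢
    rw [h1, h2, ← h3]
    ring
  have herr : ∀ N : ℕ, 0 < N → Real.exp (γ * T) * ζ T - z 0
      - σ * expStieltjesSum γ (τ / N) (N * i) w
      = ∑ k ∈ Finset.range (N * i), Real.exp (γ * (k * (τ / N))) *
        ((Real.exp (γ * (τ / N)) - 1) * ζ (k * (τ / N) + τ / N)
          - γ * ∫ r in (k * (τ / N))..(k * (τ / N) + τ / N), ζ r) := by
    intro N hN
    have htel := Finset.sum_range_sub
      (fun k : ℕ => Real.exp (γ * (k * (τ / N))) * ζ (k * (τ / N))) (N * i)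
    have hend : ((N * i : ℕ) : ℝ) * (τ / N) = T := by
      rw [hT]; push_cast; field_simp
    have hz0 : ζ 0 = z 0 := by simp [hζdef]
    simp only [hend, Nat.cast_zero, zero_mul, mul_zero, Real.exp_zero, one_mul, hz0] at htel
    rw [← htel, expStieltjesSum, Finset.mul_sum, ← Finset.sum_sub_distrib]
    refine Finset.sum_congr rfl fun k _ => ?_
    have hk : ((k + 1 : ℕ) : ℝ) * (τ / N) = k * (τ / N) + τ / N := by push_cast; ring
    have h := hincr (k * (τ / N)) (τ / N) (by positivity) (by positivity)
    rw [hk, mul_add γ, Real.exp_add]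
    linear_combination Real.exp (γ * (k * (τ / N))) * h
  have hδ : Tendsto (fun N : ℕ => τ / (N : ℝ)) atTop (𝓝 0) :=
    tendsto_const_div_atTop_nhds_zero_nat τ
  rw [tendsto_iff_dist_tendsto_zero, Metric.tendsto_nhds]
  intro η hη
  set D : ℝ := T * Real.exp (γ * T) with hD
  have hD0 : 0 ≤ D := by positivity
  -- This makes `D γ ε ≤ η/2`; the `+ 1` covers `D = 0`, which occurs for `i = 0`.
  set ε : ℝ := η / (2 * (D * γ + 1)) with hε
  have hε0 : 0 < ε := by positivity
  obtain ⟨δ₀, hδ₀, hmod⟩ := huc ε hε0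
  have hlim : Tendsto (fun N : ℕ => D * (γ ^ 2 * (τ / N) * C)) atTop (𝓝 0) := by
    simpa using ((hδ.const_mul (γ ^ 2)).mul_const C).const_mul D
  filter_upwards [eventually_gt_atTop 0, hδ.eventually_lt_const hδ₀,
    hδ.eventually_lt_const (show (0 : ℝ) < 1 / γ by positivity),
    hlim.eventually_lt_const (show 0 < η / 2 by positivity)] with N hN h1 h2 h3
  rw [Real.dist_0_eq_abs, abs_of_nonneg dist_nonneg, dist_comm, Real.dist_eq, herr N hN]
  have hNpos : (0 : ℝ) < N := by exact_mod_cast hN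
  have hterm : ∀ k ∈ Finset.range (N * i), |Real.exp (γ * (k * (τ / N))) *
        ((Real.exp (γ * (τ / N)) - 1) * ζ (k * (τ / N) + τ / N)
          - γ * ∫ r in (k * (τ / N))..(k * (τ / N) + τ / N), ζ r)|
      ≤ Real.exp (γ * T) * (τ / N * (γ * ε + γ ^ 2 * (τ / N) * C)) := by
    intro k hk
    have hk : ((k + 1 : ℕ) : ℝ) ≤ (N * i : ℕ) := by exact_mod_cast Finset.mem_range.1 hk
    have hend : (k : ℝ) * (τ / N) + τ / N ≤ T := by
      calc (k : ℝ) * (τ / N) + τ / N = ((k + 1 : ℕ) : ℝ) * (τ / N) := by push_cast; ring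
        _ ≤ (N * i : ℕ) * (τ / N) := by gcongr
        _ = T := by rw [hT]; push_cast; field_simp
    have hδN : 0 < τ / N := by positivity
    have hs : (0 : ℝ) ≤ k * (τ / N) := by positivity
    rw [abs_mul, Real.abs_exp]
    refine mul_le_mul (Real.exp_le_exp.2 ?_) ?_ (abs_nonneg _) (Real.exp_pos _).le
    · gcongr; linarith
    · refine abs_langevin_cell_error_le hζ hγ hδN ?_ ?_ ?_
      · rw [lt_div_iff₀ hγ] at h2; linarith
      · exact hC _ ⟨by linarith, hend⟩
      · intro r hr
        refine (hmod _ ⟨by linarith, hend⟩ r ⟨by linarith [hr.1], by linarith [hr.2]⟩ ?_).le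
        rw [Real.dist_eq, abs_of_nonneg (by linarith [hr.2])]
        linarith [hr.1]
  calc _ ≤ ∑ k ∈ Finset.range (N * i),
        Real.exp (γ * T) * (τ / N * (γ * ε + γ ^ 2 * (τ / N) * C)) :=
        (Finset.abs_sum_le_sum_abs _ _).trans (Finset.sum_le_sum hterm)
    _ = D * γ * ε + D * (γ ^ 2 * (τ / N) * C) := by
        rw [Finset.sum_const, Finset.card_range, nsmul_eq_mul, hD, hT]
        push_cast
        field_simp
    _ < η / 2 + η / 2 := by
        refine add_lt_add_of_le_of_lt ?_ h3
        rw [hε, mul_div_assoc', div_le_div_iff₀ (by positivity) (by positivity)]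
        nlinarith
    _ = η := by ring

/-- Characteristic functions converge both by dominated convergence and by their explicit Gaussian
form, and they determine the law. -/
theorem hasLaw_gaussianReal_of_tendsto {Ω : Type*} [MeasurableSpace Ω] {P : Measure Ω}
    [IsProbabilityMeasure P] {X : ℕ → Ω → ℝ} {Y : Ω → ℝ} {v : ℕ → ℝ≥0} {v₀ : ℝ≥0}
    (hX : ∀ N, HasLaw (X N) (gaussianReal 0 (v N)) P) (hv : Tendsto v atTop (𝓝 v₀))
    (hlim : ∀ᵐ ω ∂P, Tendsto (fun N => X N ω) atTop (𝓝 (Y ω))) :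
    HasLaw Y (gaussianReal 0 v₀) P := by
  have hYm : AEMeasurable Y P := aemeasurable_of_tendsto_metrizable_ae atTop
    (fun N => (hX N).aemeasurable) hlim
  refine ⟨hYm, ?_⟩
  have := Measure.isProbabilityMeasure_map hYm
  refine Measure.ext_of_charFun (funext fun t => ?_)
  have h1 : Tendsto (fun N => charFun (P.map (X N)) t) atTop (𝓝 (charFun (P.map Y) t)) := by
    have hc : ∀ {U : Ω → ℝ}, AEMeasurable U P →
        charFun (P.map U) t = ∫ ω, Complex.exp (t * U ω * Complex.I) ∂P := by
      intro U hU
      rw [charFun_apply_real, integral_map hU (by fun_prop)]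
    simp only [hc hYm, fun N => hc (hX N).aemeasurable]
    refine tendsto_integral_of_dominated_convergence (fun _ => 1) (fun N => ?_)
      (integrable_const _) (fun N => Eventually.of_forall fun ω => ?_) ?_
    · have hm := (hX N).aemeasurable
      have : AEMeasurable (fun ω => Complex.exp (t * X N ω * Complex.I)) P := by fun_prop
      exact this.aestronglyMeasurable
    · rw [← Complex.ofReal_mul, Complex.norm_exp_ofReal_mul_I]
    · filter_upwards [hlim] with ω hω
      have hcont : Continuous fun x : ℝ => Complex.exp (t * x * Complex.I) := by fun_prop
      exact (hcont.tendsto _).comp hω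
  have h2 : Tendsto (fun N => charFun (P.map (X N)) t) atTop
      (𝓝 (charFun (gaussianReal 0 v₀) t)) := by
    simp only [(hX _).map_eq, charFun_gaussianReal]
    have hcont : Continuous fun x : ℝ≥0 =>
        Complex.exp (t * (0 : ℝ) * Complex.I - ((x : ℝ) : ℂ) * t ^ 2 / 2) := by fun_prop
    exact (hcont.tendsto _).comp hv
  exact tendsto_nhds_unique h1 h2

variable {Ω : Type*} [MeasurableSpace Ω] {P : Measure Ω} {W : ℝ≥0 → Ω → ℝ}

theorem covariance_brownian_increments (hW : IsPreBrownianReal W P) {δ : ℝ} (hδ : 0 ≤ δ)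
    (k l : ℕ) :
    cov[fun ω => W (Real.toNNReal ((k + 1 : ℕ) * δ)) ω - W (Real.toNNReal (k * δ)) ω,
      fun ω => W (Real.toNNReal ((l + 1 : ℕ) * δ)) ω - W (Real.toNNReal (l * δ)) ω; P]
      = if k = l then δ else 0 := by
  have := hW.isGaussianProcess.isProbabilityMeasure
  have hm : ∀ t, MemLp (W t) 2 P := fun t => (hW.isGaussianProcess.hasGaussianLaw_eval t).memLp_two
  have hmin : ∀ p q : ℕ, cov[W (Real.toNNReal (p * δ)), W (Real.toNNReal (q * δ)); P]
      = (min p q : ℕ) * δ := by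
    intro p q
    rw [hW.covariance_eval, NNReal.coe_min, Real.coe_toNNReal _ (by positivity),
      Real.coe_toNNReal _ (by positivity), ← min_mul_of_nonneg _ _ hδ, Nat.cast_min]
  rw [covariance_fun_sub_fun_sub (hm _) (hm _) (hm _) (hm _)]
  rw [hmin, hmin, hmin, hmin]
  rcases lt_trichotomy k l with h | rfl | h
  · rw [if_neg h.ne, min_eq_left (by omega : k + 1 ≤ l + 1), min_eq_left (by omega : k + 1 ≤ l),
      min_eq_left (by omega : k ≤ l + 1), min_eq_left (by omega : k ≤ l)]
    ring
  · rw [if_pos rfl, min_self, min_self, min_eq_right (by omega : k ≤ k + 1),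
      min_eq_left (by omega : k ≤ k + 1)]
    push_cast; ring
  · rw [if_neg h.ne', min_eq_right (by omega : l + 1 ≤ k + 1), min_eq_right (by omega : l ≤ k + 1),
      min_eq_right (by omega : l + 1 ≤ k), min_eq_right (by omega : l ≤ k)]
    ring

theorem isGaussianProcess_expStieltjesSum (hW : IsPreBrownianReal W P) (γ δ : ℝ) :
    IsGaussianProcess (fun (m : ℕ) ω => expStieltjesSum γ δ m fun t => W t ω) P := by
  refine hW.isGaussianProcess.of_isGaussianProcess fun m =>
    ⟨(Finset.range (m + 1)).image fun k : ℕ => Real.toNNReal (k * δ),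
      ∑ k : Fin m, Real.exp (γ * (k * δ)) •
        (ContinuousLinearMap.proj ⟨Real.toNNReal (((k + 1 : ℕ) : ℝ) * δ),
            Finset.mem_image_of_mem (fun k : ℕ => Real.toNNReal (k * δ))
              (Finset.mem_range.2 (by omega))⟩
          - ContinuousLinearMap.proj ⟨Real.toNNReal (((k : ℕ) : ℝ) * δ),
            Finset.mem_image_of_mem (fun k : ℕ => Real.toNNReal (k * δ))
              (Finset.mem_range.2 (by omega))⟩), fun ω => ?_⟩
  rw [expStieltjesSum, ← Fin.sum_univ_eq_sum_range
    (fun k => Real.exp (γ * (k * δ)) * (W (Real.toNNReal ((k + 1 : ℕ) * δ)) ω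
      - W (Real.toNNReal (k * δ)) ω))]
  simp

theorem covariance_expStieltjesSum (hW : IsPreBrownianReal W P) (γ : ℝ) {δ : ℝ} (hδ : 0 ≤ δ)
    (m m' : ℕ) :
    cov[fun ω => expStieltjesSum γ δ m fun t => W t ω,
      fun ω => expStieltjesSum γ δ m' fun t => W t ω; P]
      = ∑ k ∈ Finset.range (min m m'), Real.exp (2 * γ * (k * δ)) * δ := by
  have := hW.isGaussianProcess.isProbabilityMeasure
  have hm : ∀ t, MemLp (W t) 2 P := fun t => (hW.isGaussianProcess.hasGaussianLaw_eval t).memLp_two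
  unfold expStieltjesSum
  have hterm : ∀ k : ℕ, MemLp (fun ω => Real.exp (γ * (k * δ)) *
      (W (Real.toNNReal ((k + 1 : ℕ) * δ)) ω - W (Real.toNNReal (k * δ)) ω)) 2 P :=
    fun k => ((hm _).sub (hm _)).const_mul _
  rw [covariance_fun_sum_fun_sum' (fun k _ => hterm k) (fun k _ => hterm k)]
  simp only [covariance_const_mul_left, covariance_const_mul_right,
    covariance_brownian_increments hW hδ, mul_ite, mul_zero, Finset.sum_ite_eq]
  rw [← Finset.sum_filter]
  refine Finset.sum_congr (by ext; simp) fun k _ => ?_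
  rw [← mul_assoc, ← Real.exp_add]
  ring_nf

theorem integral_expStieltjesSum (hW : IsPreBrownianReal W P) (γ δ : ℝ) (m : ℕ) :
    ∫ ω, expStieltjesSum γ δ m (fun t => W t ω) ∂P = 0 := by
  unfold expStieltjesSum
  have hterm : ∀ k : ℕ, Integrable (fun ω => Real.exp (γ * (k * δ)) *
      (W (Real.toNNReal ((k + 1 : ℕ) * δ)) ω - W (Real.toNNReal (k * δ)) ω)) P :=
    fun k => ((hW.integrable_eval _).sub (hW.integrable_eval _)).const_mul _
  rw [integral_finsetSum _ fun k _ => hterm k]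
  refine Finset.sum_eq_zero fun k _ => ?_
  rw [integral_const_mul, integral_sub (hW.integrable_eval _) (hW.integrable_eval _),
    hW.integral_eval, hW.integral_eval, sub_zero, mul_zero]

theorem hasLaw_sum_expStieltjesSum (hW : IsPreBrownianReal W P) (γ : ℝ) {δ : ℝ} (hδ : 0 ≤ δ)
    (S : Finset ℕ) (N : ℕ) (c : ℕ → ℝ) :
    HasLaw (fun ω => ∑ i ∈ S, c i * expStieltjesSum γ δ (N * i) fun t => W t ω)
      (gaussianReal 0 (Real.toNNReal (∑ i ∈ S, ∑ j ∈ S, c i * c j *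
        ∑ k ∈ Finset.range (N * min i j), Real.exp (2 * γ * (k * δ)) * δ))) P := by
  have hg := isGaussianProcess_expStieltjesSum hW γ δ
  have hmem : ∀ m, MemLp (fun ω => expStieltjesSum γ δ m fun t => W t ω) 2 P :=
    fun m => (hg.hasGaussianLaw_eval m).memLp_two
  have hgc := ((hg.comp_right fun i => N * i).smul c).hasGaussianLaw_fun_sum (I := S)
  simp only [Function.comp_def, smul_eq_mul] at hgc
  have := hg.isProbabilityMeasure
  refine ⟨hgc.aemeasurable, ?_⟩
  rw [hgc.map_eq_gaussianReal]
  congr 1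
  · rw [integral_finsetSum _ fun i _ => ((hg.hasGaussianLaw_eval (N * i)).integrable).const_mul _]
    refine Finset.sum_eq_zero fun i _ => ?_
    rw [integral_const_mul, integral_expStieltjesSum hW, mul_zero]
  · rw [← covariance_self hgc.aemeasurable,
      covariance_fun_sum_fun_sum' (fun k _ => (hmem _).const_mul _)
        (fun k _ => (hmem _).const_mul _)]
    simp only [covariance_const_mul_left, covariance_const_mul_right,
      covariance_expStieltjesSum hW γ hδ, Nat.mul_min_mul_left]
    congr 1
    refine Finset.sum_congr rfl fun i _ => Finset.sum_congr rfl fun j _ => by ring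

/-- The geometric sum is explicit, and `δ / (e^{2γδ} - 1) → 1/(2γ)` by the derivative of `exp` at
`0`. -/
theorem tendsto_sum_exp_riemann {γ τ : ℝ} (hγ : 0 < γ) (hτ : 0 < τ) (m : ℕ) :
    Tendsto (fun N : ℕ => ∑ k ∈ Finset.range (N * m),
        Real.exp (2 * γ * (k * (τ / N))) * (τ / N)) atTop
      (𝓝 ((Real.exp (2 * γ * (m * τ)) - 1) / (2 * γ))) := by
  have hδ : Tendsto (fun N : ℕ => τ / (N : ℝ)) atTop (𝓝[≠] 0) := by
    refine tendsto_nhdsWithin_iff.2 ⟨tendsto_const_div_atTop_nhds_zero_nat τ, ?_⟩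
    filter_upwards [eventually_gt_atTop 0] with N hN
    have : (0 : ℝ) < N := by exact_mod_cast hN
    exact (by positivity : τ / (N : ℝ) ≠ 0)
  have hslope : Tendsto (fun δ : ℝ => (Real.exp (2 * γ * δ) - 1) / δ) (𝓝[≠] 0)
      (𝓝 (2 * γ)) := by
    have h : HasDerivAt (fun δ : ℝ => Real.exp (2 * γ * δ)) (2 * γ) 0 := by
      have := ((hasDerivAt_id (0 : ℝ)).const_mul (2 * γ)).exp
      simpa using this
    refine (hasDerivAt_iff_tendsto_slope.1 h).congr fun δ => ?_
    simp [slope_def_field]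
  have h := (hslope.comp hδ).inv₀ (by positivity) |>.const_mul (Real.exp (2 * γ * (m * τ)) - 1)
  rw [← div_eq_mul_inv] at h
  refine h.congr' ?_
  filter_upwards [eventually_gt_atTop 0] with N hN
  have hN' : (0 : ℝ) < N := by exact_mod_cast hN
  have hne : Real.exp (2 * γ * (τ / N)) - 1 ≠ 0 :=
    (sub_pos.2 (Real.one_lt_exp_iff.2 (by positivity))).ne'
  have hgeom := geom_sum_mul (Real.exp (2 * γ * (τ / N))) (N * m)
  simp only [← Real.exp_nat_mul] at hgeom
  have hE : ((N * m : ℕ) : ℝ) * (2 * γ * (τ / N)) = 2 * γ * (m * τ) := by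
    push_cast; field_simp
  rw [hE] at hgeom
  rw [← Finset.sum_mul, Function.comp_apply, inv_div, ← hgeom,
    Finset.sum_congr rfl fun (k : ℕ) _ =>
      show Real.exp (2 * γ * (k * (τ / N))) = Real.exp (k * (2 * γ * (τ / N))) by ring_nf,
    mul_assoc, mul_div_cancel₀ _ hne]

theorem growthProcess_eq_sum_powerset (ρ x₀ v : ℝ) {Y : ℕ → Ω → ℝ}
    (hv : ∀ i, variance (Y i) P = v) (n : ℕ) (ω : Ω) :
    growthProcess P ρ x₀ Y n ω = x₀ * ∑ S ∈ (Finset.range n).powerset,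
      (ρ ^ S.card * Real.exp (-(v / 2 * S.card))) * Real.exp (∑ i ∈ S, Y i ω) := by
  have h1 : growthProcess P ρ x₀ Y n ω
      = x₀ * ∏ i ∈ Finset.range n, (1 + ρ * Real.exp (Y i ω - v / 2)) := by
    induction n with
    | zero => simp [growthProcess]
    | succ n ih =>
      rw [growthProcess, ih, Finset.prod_range_succ, hv]
      ring_nf
  rw [h1, Finset.prod_one_add]
  congr 1
  refine Finset.sum_congr rfl fun S _ => ?_
  rw [Finset.prod_mul_distrib, Finset.prod_const, ← Real.exp_sum, Finset.sum_sub_distrib,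
    Finset.sum_const, nsmul_eq_mul, mul_assoc, ← Real.exp_add]
  ring_nf

variable [IsProbabilityMeasure P] {Z : ℝ≥0 → Ω → ℝ} {γ σ τ : ℝ}

/-- Writing `Z_{iτ} = e_i Z_0 + e_i (e^{γiτ} Z_{iτ} - Z_0)`, the sum over `S` is an independent
Gaussian initial part plus a limit of Gaussian Brownian sums. -/
theorem IsStationaryOU.hasLaw_sum_sampled (h : IsStationaryOU P γ σ W Z) (hγ : 0 < γ) (hτ : 0 < τ)
    (S : Finset ℕ) :
    HasLaw (fun ω => ∑ i ∈ S, sampled τ Z i ω) (gaussianReal 0 (Real.toNNReal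
      (σ ^ 2 / (2 * γ) * ∑ i ∈ S, ∑ j ∈ S, Real.exp (-(γ * τ * |(i : ℝ) - j|))))) P := by
  have hW := h.brownian.toIsPreBrownianReal
  set e : ℕ → ℝ := fun i => Real.exp (-(γ * (i * τ))) with he
  set V : ℕ → ℝ := fun N => ∑ i ∈ S, ∑ j ∈ S, e i * e j *
        ∑ k ∈ Finset.range (N * min i j), Real.exp (2 * γ * (k * (τ / N))) * (τ / N) with hV
  set A : ℝ := ∑ i ∈ S, e i with hA
  refine hasLaw_gaussianReal_of_tendsto
    (X := fun N ω => A * Z 0 ω + σ * ∑ i ∈ S, e i *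
      expStieltjesSum γ (τ / N) (N * i) fun t => W t ω)
    (v := fun N => Real.toNNReal (A ^ 2 * (σ ^ 2 / (2 * γ)) + σ ^ 2 * V N)) (fun N => ?_) ?_ ?_
  · have hδ : 0 ≤ τ / (N : ℝ) := by positivity
    have h1 := gaussianReal_const_mul h.initial_law A
    have h2 := gaussianReal_const_mul (hasLaw_sum_expStieltjesSum hW γ hδ S N e) σ
    have hind : IndepFun (fun ω => A * Z 0 ω) (fun ω => σ * ∑ i ∈ S, e i *
        expStieltjesSum γ (τ / N) (N * i) fun t => W t ω) P := by
      refine h.initial_indep.comp (φ := fun x => A * x)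
        (ψ := fun w : ℝ≥0 → ℝ => σ * ∑ i ∈ S, e i * expStieltjesSum γ (τ / N) (N * i) w)
        (by fun_prop) ?_
      unfold expStieltjesSum
      fun_prop
    have h3 := gaussianReal_add_gaussianReal_of_indepFun hind h1.map_eq h2.map_eq
    refine ⟨h1.aemeasurable.add h2.aemeasurable, ?_⟩
    rw [show (fun ω => A * Z 0 ω + σ * ∑ i ∈ S, e i *
      expStieltjesSum γ (τ / N) (N * i) fun t => W t ω) = (fun ω => A * Z 0 ω) + (fun ω =>
      σ * ∑ i ∈ S, e i * expStieltjesSum γ (τ / N) (N * i) fun t => W t ω) from rfl, h3]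
    have hVnn : 0 ≤ V N := by
      refine Finset.sum_nonneg fun i _ => Finset.sum_nonneg fun j _ => mul_nonneg (by positivity)
        (Finset.sum_nonneg fun k _ => by positivity)
    congr 1
    · simp
    · rw [Real.toNNReal_add (by positivity) (by positivity), Real.toNNReal_mul (by positivity),
        Real.toNNReal_mul (by positivity)]
      congr 2 <;> (ext; simp [sq_nonneg])
  · refine (continuous_real_toNNReal.tendsto _).comp ?_
    have hlimV : Tendsto V atTop (𝓝 (∑ i ∈ S, ∑ j ∈ S, e i * e j *
        ((Real.exp (2 * γ * ((min i j : ℕ) * τ)) - 1) / (2 * γ)))) :=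
      tendsto_finsetSum _ fun i _ => tendsto_finsetSum _ fun j _ =>
        (tendsto_sum_exp_riemann hγ hτ _).const_mul _
    convert (hlimV.const_mul (σ ^ 2)).const_add (A ^ 2 * (σ ^ 2 / (2 * γ))) using 2
    rw [hA, sq (∑ i ∈ S, e i), Finset.sum_mul_sum, Finset.sum_mul, Finset.mul_sum, Finset.mul_sum,
      ← Finset.sum_add_distrib]
    refine Finset.sum_congr rfl fun i _ => ?_
    rw [Finset.sum_mul, Finset.mul_sum, Finset.mul_sum, ← Finset.sum_add_distrib]
    refine Finset.sum_congr rfl fun j _ => ?_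
    -- Stationarity: the initial variance cancels the `-1` in the Brownian covariance, leaving this
    -- stationary correlation.
    have h2 : Real.exp (-(γ * τ * |(i : ℝ) - j|))
        = e i * e j * Real.exp (2 * γ * ((min i j : ℕ) * τ)) := by
      rw [he, ← Real.exp_add, ← Real.exp_add]
      congr 1
      rcases le_total i j with h | h
      · have h' : (i : ℝ) ≤ j := by exact_mod_cast h
        rw [min_eq_left h, abs_of_nonpos (by linarith)]; ring
      · have h' : (j : ℝ) ≤ i := by exact_mod_cast h
        rw [min_eq_right h, abs_of_nonneg (by linarith)]; ring
    rw [h2]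
    field_simp
    ring
  · filter_upwards [h.continuous_paths, h.sde] with ω hc hs
    have hl : Tendsto (fun N : ℕ => A * Z 0 ω + ∑ i ∈ S, e i *
        (σ * expStieltjesSum γ (τ / N) (N * i) fun t => W t ω)) atTop
        (𝓝 (A * Z 0 ω + ∑ i ∈ S, e i * (Real.exp (γ * (i * τ)) * Z (Real.toNNReal (i * τ)) ω
          - Z 0 ω))) :=
      (tendsto_finsetSum _ fun i _ =>
        (tendsto_expStieltjesSum hc hγ hτ hs i).const_mul _).const_add _
    convert hl using 2
    · rw [Finset.mul_sum]
      congr 1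
      exact Finset.sum_congr rfl fun i _ => by ring
    · rw [hA, Finset.sum_mul, ← Finset.sum_add_distrib]
      refine Finset.sum_congr rfl fun i _ => ?_
      have : e i * Real.exp (γ * (i * τ)) = 1 := by rw [he, ← Real.exp_add]; simp
      rw [sampled]
      linear_combination -(Z (Real.toNNReal (i * τ)) ω) * this

theorem IsStationaryOU.variance_sampled (h : IsStationaryOU P γ σ W Z) (hγ : 0 < γ) (hτ : 0 < τ)
    (i : ℕ) : variance (sampled τ Z i) P = σ ^ 2 / (2 * γ) := by
  have h1 := h.hasLaw_sum_sampled hγ hτ {i}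
  simp only [Finset.sum_singleton, sub_self, abs_zero, mul_zero, neg_zero, Real.exp_zero,
    mul_one] at h1
  have h2 := h1.variance_eq
  rw [variance_id_gaussianReal, Real.coe_toNNReal _ (by positivity)] at h2
  exact h2

theorem IsStationaryOU.integrable_exp_sum_sampled (h : IsStationaryOU P γ σ W Z) (hγ : 0 < γ)
    (hτ : 0 < τ) (S : Finset ℕ) :
    Integrable (fun ω => Real.exp (∑ i ∈ S, sampled τ Z i ω)) P := by
  have h1 := h.hasLaw_sum_sampled hγ hτ S
  have h2 := integrable_exp_mul_gaussianReal (μ := 0) (v := Real.toNNReal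
      (σ ^ 2 / (2 * γ) * ∑ i ∈ S, ∑ j ∈ S, Real.exp (-(γ * τ * |(i : ℝ) - j|)))) 1
  rw [← h1.map_eq] at h2
  simpa [Function.comp_def] using h2.comp_aemeasurable h1.aemeasurable

theorem IsStationaryOU.integral_exp_sum_sampled (h : IsStationaryOU P γ σ W Z) (hγ : 0 < γ)
    (hτ : 0 < τ) (S : Finset ℕ) :
    ∫ ω, Real.exp (∑ i ∈ S, sampled τ Z i ω) ∂P = Real.exp
      (σ ^ 2 / (4 * γ) * ∑ i ∈ S, ∑ j ∈ S, Real.exp (-(γ * τ * |(i : ℝ) - j|))) := by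
  have h1 := mgf_gaussianReal (h.hasLaw_sum_sampled hγ hτ S).map_eq 1
  rw [Real.coe_toNNReal _ (mul_nonneg (by positivity) (Finset.sum_nonneg fun i _ =>
    Finset.sum_nonneg fun j _ => (Real.exp_pos _).le))] at h1
  simp only [mgf, one_mul] at h1
  rw [h1]
  congr 1
  field_simp
  ring

theorem IsStationaryOU.integrable_growth (h : IsStationaryOU P γ σ W Z) (hγ : 0 < γ)
    (hτ : 0 < τ) (ρ x₀ : ℝ) (n : ℕ) :
    Integrable (growthProcess P ρ x₀ (sampled τ Z) n) P := by
  rw [funext (growthProcess_eq_sum_powerset ρ x₀ _ (h.variance_sampled hγ hτ) n)]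
  exact (integrable_finsetSum _ fun S _ =>
    (h.integrable_exp_sum_sampled hγ hτ S).const_mul _).const_mul _

/-- The normalisation `-Var/2` of each factor becomes the shift of the chemical potential; it
offsets the diagonal of the interaction. -/
theorem IsStationaryOU.integral_growth_eq (h : IsStationaryOU P γ σ W Z) (hγ : 0 < γ)
    (hτ : 0 < τ) {ρ : ℝ} (hρ : 0 < ρ) (x₀ : ℝ) (n : ℕ) :
    ∫ ω, growthProcess P ρ x₀ (sampled τ Z) n ω ∂P
      = x₀ * partitionSum (Finset.range n) (Real.log ρ - σ ^ 2 / (4 * γ))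
        (fun i j => σ ^ 2 / (4 * γ) * Real.exp (-(γ * τ * |(i : ℝ) - j|))) := by
  rw [funext (growthProcess_eq_sum_powerset ρ x₀ _ (h.variance_sampled hγ hτ) n),
    integral_const_mul, integral_finsetSum _ fun S _ =>
    (h.integrable_exp_sum_sampled hγ hτ S).const_mul _, partitionSum]
  congr 1
  refine Finset.sum_congr rfl fun S _ => ?_
  rw [integral_const_mul, h.integral_exp_sum_sampled hγ hτ]
  nth_rw 1 [← Real.exp_log hρ]
  rw [← Real.exp_nat_mul, ← Real.exp_add, ← Real.exp_add]
  simp only [Finset.mul_sum]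
  congr 2
  field_simp
  ring

end OrnsteinUhlenbeck

/-! ### Convergence of the free energy per site -/

section FreeEnergy

variable {β a : ℝ}

theorem siteKernel_comm (β a : ℝ) (n i j : ℕ) : siteKernel β a n i j = siteKernel β a n j i := by
  rw [siteKernel, siteKernel, interactionKernel_comm]

theorem siteKernel_eq (β a : ℝ) (n : ℕ) : siteKernel β a n =
    fun i j : ℕ => β / n * (1 / (2 * a)) * Real.exp (-(a / n * |(i : ℝ) - j|)) := by
  ext i j
  rw [siteKernel, interactionKernel, ← sub_div, abs_div, Nat.abs_cast]
  ring_nf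

theorem quadForm_siteKernel_nonneg (hβ : 0 ≤ β) (ha : 0 < a) (n : ℕ) (c : ℕ → ℝ) :
    0 ≤ quadForm (Finset.range n) (siteKernel β a n) c := by
  rw [siteKernel_eq β a n]
  exact quadForm_exp_neg_abs_sub_nonneg n (by positivity) (by positivity) c

theorem partitionSum_pos (s : Finset ℕ) (L : ℝ) (κ : ℕ → ℕ → ℝ) : 0 < partitionSum s L κ :=
  Finset.sum_pos (fun _ _ => Real.exp_pos _) (Finset.powerset_nonempty s)

theorem meanFieldEnergy_sub_left (s : Finset ℕ) (L ε : ℝ) (κ : ℕ → ℕ → ℝ) (u : ℕ → ℝ) :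
    meanFieldEnergy s (L - ε) κ u = meanFieldEnergy s L κ u - ε * ∑ i ∈ s, u i := by
  simp only [meanFieldEnergy, Finset.mul_sum, sub_mul, Finset.sum_sub_distrib]
  ring

theorem sum_range_mem_Icc {u : ℕ → ℝ} (hu : ∀ i, u i ∈ Icc (0 : ℝ) 1) (n : ℕ) :
    ∑ i ∈ Finset.range n, u i ∈ Icc (0 : ℝ) n :=
  ⟨Finset.sum_nonneg fun i _ => (hu i).1,
    (Finset.sum_le_sum fun i _ => (hu i).2).trans_eq (by simp)⟩

/-- The shift of the chemical potential costs at most `β/(2a)` over all `n` sites; the other `β/n`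
is the discretisation error. -/
theorem rateFunctional_le_log_partitionSum (ρ : ℝ) (hβ : 0 ≤ β) (ha : 0 < a) {g : ℝ → ℝ}
    (hg : g ∈ admissibleSet) {n : ℕ} (hn : 0 < n) :
    rateFunctional ρ β a g ≤ 1 / n * Real.log (partitionSum (Finset.range n)
      (Real.log ρ - β / (2 * a * n)) (siteKernel β a n)) + (β / (2 * a) + β) / n := by
  obtain ⟨θ, hθ, h⟩ := exists_rateFunctional_le_meanFieldEnergy ρ hβ ha hg hn
  have hn' : (0 : ℝ) < n := by exact_mod_cast hn
  have h1 := exp_meanFieldEnergy_le_partitionSum (siteKernel_comm β a n)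
    (quadForm_siteKernel_nonneg hβ ha n) (Real.log ρ - β / (2 * a * n)) hθ
  rw [← Real.le_log_iff_exp_le (partitionSum_pos _ _ _), meanFieldEnergy_sub_left] at h1
  have h2 : β / (2 * a * n) * ∑ i ∈ Finset.range n, θ i ≤ β / (2 * a) := by
    calc _ ≤ β / (2 * a * n) * n := by gcongr; exact (sum_range_mem_Icc hθ n).2
      _ = _ := by field_simp
  refine h.trans ?_
  calc 1 / n * meanFieldEnergy (Finset.range n) (Real.log ρ) (siteKernel β a n) θ + β / n
      ≤ 1 / n * (Real.log (partitionSum (Finset.range n)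
      (Real.log ρ - β / (2 * a * n)) (siteKernel β a n)) + β / (2 * a)) + β / n := by
        gcongr; linarith
    _ = _ := by ring

/-- Site `i` lies in block `⌊i m / n⌋`, already less than `m`; the remainder `% m` only serves to
give an element of `Fin m` for every `i`. -/
theorem abs_div_sub_block_div_le {n m i : ℕ} (hm : 0 < m) (hi : i < n) :
    |(i : ℝ) / n - ((i * m / n % m : ℕ) : ℝ) / m| ≤ 1 / m := by
  have hn : 0 < n := by omega
  have hlt : i * m / n < m := by
    rw [Nat.div_lt_iff_lt_mul hn, mul_comm m]; gcongr
  rw [Nat.mod_eq_of_lt hlt]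
  have h1 : ((i * m / n : ℕ) : ℝ) * n ≤ i * m := by exact_mod_cast Nat.div_mul_le_self (i * m) n
  have h2 : (i : ℝ) * m < ((i * m / n : ℕ) + 1) * n := by
    exact_mod_cast Nat.lt_mul_of_div_lt (Nat.lt_succ_self _) hn
  have hn' : (0 : ℝ) < n := by exact_mod_cast hn
  have hm' : (0 : ℝ) < m := by exact_mod_cast hm
  have h3 : ((i * m / n : ℕ) : ℝ) / m ≤ i / n := by
    rwa [div_le_div_iff₀ hm' hn']
  have h4 : (i : ℝ) / n ≤ ((i * m / n : ℕ) + 1) / m := by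
    rw [div_le_div_iff₀ hn' hm']; exact h2.le
  rw [abs_of_nonneg (by linarith)]
  rw [add_div] at h4
  linarith

theorem log_partitionSum_le (ρ : ℝ) (hβ : 0 ≤ β) (ha : 0 < a) {lam : ℝ}
    (hlam : lam ∈ upperBounds (rateFunctional ρ β a '' admissibleSet)) {n m : ℕ} (hn : 0 < n)
    (hm : 0 < m) :
    1 / n * Real.log (partitionSum (Finset.range n)
      (Real.log ρ - β / (2 * a * n)) (siteKernel β a n))
      ≤ lam + β / (2 * m) + β / n + m * (Real.log (n + 1) / n) := by
  have hn' : (0 : ℝ) < n := by exact_mod_cast hn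
  have hm' : (0 : ℝ) < m := by exact_mod_cast hm
  have hM : ∀ u : ℕ → ℝ, (∀ i, u i ∈ Icc (0 : ℝ) 1) → meanFieldEnergy (Finset.range n)
      (Real.log ρ - β / (2 * a * n)) (siteKernel β a n) u ≤ n * lam + β := by
    intro u hu
    have h1 := meanFieldEnergy_le_rateFunctional_stepPrimitive ρ hβ ha hn hu
    have h2 := hlam (mem_image_of_mem _ (stepPrimitive_mem_admissibleSet n hu))
    have h3 : 0 ≤ β / (2 * a * n) * ∑ i ∈ Finset.range n, u i :=
      mul_nonneg (by positivity) (sum_range_mem_Icc hu n).1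
    have h4 := h1.trans (add_le_add_left h2 _)
    rw [one_div, inv_mul_le_iff₀ hn'] at h4
    rw [meanFieldEnergy_sub_left]
    have h5 : (n : ℝ) * (lam + β / n) = n * lam + β := by field_simp
    linarith
  -- `δ` is the Lipschitz constant `1/2` times the block width `1/m`, scaled by `β/n`; hence `n² δ /
  -- n = β/(2m)`.
  have h := partitionSum_le_of_blocks (siteKernel_comm β a n)
    (quadForm_siteKernel_nonneg hβ ha n) (δ := β / n * (1 / 2 * (1 / m))) hM
    (b := fun i => ⟨i * m / n % m, Nat.mod_lt _ hm⟩)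
    (κ' := fun k j => β / n * interactionKernel a ((k : ℕ) / m) (j / n)) (fun i hi j _ => by
      rw [siteKernel, ← mul_sub, abs_mul, abs_of_nonneg (by positivity)]
      gcongr
      refine (abs_interactionKernel_sub_le ha _ _ _).trans ?_
      gcongr
      exact abs_div_sub_block_div_le hm (Finset.mem_range.1 hi))
  have h2 := Real.log_le_log (partitionSum_pos _ _ _) h
  rw [Finset.card_range, Real.log_mul (by positivity) (Real.exp_ne_zero _), Real.log_exp,
    Real.log_pow] at h2
  calc _ ≤ 1 / (n : ℝ) * (m * Real.log (n + 1)
        + (n * lam + β + n ^ 2 * (β / n * (1 / 2 * (1 / m))))) := by gcongr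
    _ = _ := by field_simp; ring

theorem tendsto_log_succ_div : Tendsto (fun n : ℕ => Real.log (n + 1) / n) atTop (𝓝 0) := by
  have h := (Real.tendsto_pow_log_div_mul_add_atTop 1 (-1) 1 one_ne_zero).comp
    ((tendsto_natCast_atTop_atTop (R := ℝ)).atTop_add (tendsto_const_nhds (x := (1 : ℝ))))
  refine h.congr fun n => ?_
  simp

/-- The free energy per site converges to the supremum of the rate functional. -/
theorem exists_tendsto_log_partitionSum_isLUB (ρ : ℝ) (hβ : 0 ≤ β) (ha : 0 < a) :
    ∃ lam : ℝ, Tendsto (fun n : ℕ => 1 / (n : ℝ) * Real.log (partitionSum (Finset.range n)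
      (Real.log ρ - β / (2 * a * n)) (siteKernel β a n))) atTop (𝓝 lam) ∧
      IsLUB (rateFunctional ρ β a '' admissibleSet) lam := by
  have hne : (rateFunctional ρ β a '' admissibleSet).Nonempty :=
    Set.Nonempty.image _ ⟨_, stepPrimitive_mem_admissibleSet 1 (θ := fun _ => 0) (by simp)⟩
  -- The lower bound on a single partition function, at `n = 1`, already bounds the functional.
  have hbdd : BddAbove (rateFunctional ρ β a '' admissibleSet) :=
    ⟨_, forall_mem_image.2 fun _ hg => rateFunctional_le_log_partitionSum ρ hβ ha hg one_pos⟩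
  have hlub := isLUB_csSup hne hbdd
  refine ⟨sSup (rateFunctional ρ β a '' admissibleSet), ?_, hlub⟩
  set lam := sSup (rateFunctional ρ β a '' admissibleSet)
  rw [tendsto_order]
  constructor
  · intro r hr
    have hC : Tendsto (fun n : ℕ => (β / (2 * a) + β) / (n : ℝ)) atTop (𝓝 0) :=
      tendsto_const_div_atTop_nhds_zero_nat _
    filter_upwards [hC.eventually_lt_const (sub_pos.2 hr), eventually_gt_atTop 0] with n h1 hn
    have h2 : lam ≤ _ := hlub.2 (by
      rintro _ ⟨g, hg, rfl⟩
      exact rateFunctional_le_log_partitionSum ρ hβ ha hg hn)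
    linarith
  · intro r hr
    have hm0 : Tendsto (fun m : ℕ => β / (2 * (m : ℝ))) atTop (𝓝 0) := by
      simpa only [div_div] using tendsto_const_div_atTop_nhds_zero_nat (β / 2)
    -- The number of blocks is fixed before `n → ∞`, so that `m log(n+1)/n` vanishes.
    obtain ⟨m, hm1, hm⟩ := ((hm0.eventually_lt_const (half_pos (sub_pos.2 hr))).and
      (eventually_gt_atTop 0)).exists
    have hE : Tendsto (fun n : ℕ => β / (n : ℝ) + m * (Real.log (n + 1) / n)) atTop (𝓝 0) := by
      simpa using (tendsto_const_div_atTop_nhds_zero_nat β).add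
        (tendsto_log_succ_div.const_mul (m : ℝ))
    filter_upwards [hE.eventually_lt_const (half_pos (sub_pos.2 hr)), eventually_gt_atTop 0]
      with n h1 hn
    linarith [log_partitionSum_le ρ hβ ha hlub.1 hn hm]

end FreeEnergy

/-! ### The growth rate -/

theorem theorem1 (ρ β a x₀ : ℝ) (hρ : 0 < ρ) (hx₀ : 0 < x₀)
    (γ σ τ : ℕ → ℝ) (hγ : ∀ n, 1 ≤ n → 0 < γ n) (hτ : ∀ n, 1 ≤ n → 0 < τ n)
    (hβ : ∀ n : ℕ, 1 ≤ n → (1 / 2) * (σ n) ^ 2 * τ n * (n : ℝ) ^ 2 = β)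
    (ha : ∀ n : ℕ, 1 ≤ n → γ n * n * τ n = a)
    {Ω : ℕ → Type*} [∀ n, MeasurableSpace (Ω n)] (P : ∀ n, Measure (Ω n))
    [∀ n, IsProbabilityMeasure (P n)]
    (W Z : ∀ n, ℝ≥0 → Ω n → ℝ)
    (hZ : ∀ n, 1 ≤ n → IsStationaryOU (P n) (γ n) (σ n) (W n) (Z n)) :
    (∀ n, 1 ≤ n → Integrable (growthProcess (P n) ρ x₀ (sampled (τ n) (Z n)) n) (P n)) ∧
    ∃ lam : ℝ,
      Tendsto
        (fun n : ℕ => (1 / (n : ℝ)) *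
          Real.log (∫ ω, growthProcess (P n) ρ x₀ (sampled (τ n) (Z n)) n ω ∂(P n)))
        atTop (𝓝 lam) ∧
      IsLUB (rateFunctional ρ β a '' admissibleSet) lam := by
  refine ⟨fun n hn => (hZ n hn).integrable_growth (hγ n hn) (hτ n hn) ρ x₀ n, ?_⟩
  have hβ0 : 0 ≤ β := by
    have := hτ 1 le_rfl
    rw [← hβ 1 le_rfl]; positivity
  have ha0 : 0 < a := by
    have := hτ 1 le_rfl
    have := hγ 1 le_rfl
    rw [← ha 1 le_rfl]; positivity
  obtain ⟨lam, hlim, hlub⟩ := exists_tendsto_log_partitionSum_isLUB ρ hβ0 ha0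
  refine ⟨lam, ?_, hlub⟩
  have hx := (tendsto_const_div_atTop_nhds_zero_nat (Real.log x₀)).add hlim
  rw [zero_add] at hx
  refine hx.congr' ?_
  filter_upwards [eventually_ge_atTop 1] with n hn
  have hγn := hγ n hn
  have hτn := hτ n hn
  have hn' : (0 : ℝ) < n := by exact_mod_cast hn
  -- The scaling fixes the coupling at `β/(2an)` and the decay rate at `γτ = a/n`, which is exactly
  -- `siteKernel`.
  have hvar : σ n ^ 2 / (4 * γ n) = β / (2 * a * n) := by
    rw [← hβ n hn, ← ha n hn]; field_simp; ring
  have hker : (fun i j : ℕ => σ n ^ 2 / (4 * γ n) *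
      Real.exp (-(γ n * τ n * |(i : ℝ) - j|))) = siteKernel β a n := by
    rw [siteKernel_eq β a n]
    ext i j
    rw [hvar, show γ n * τ n = a / n by rw [← ha n hn]; field_simp]
    congr 1
    field_simp
  rw [(hZ n hn).integral_growth_eq hγn hτn hρ x₀ n, hker, hvar,
    Real.log_mul hx₀.ne' (partitionSum_pos _ _ _).ne']
  ring
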